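/- Let $n\ge 1$ and let $B$ be the closed Euclidean unit ball of $\mathbb R^n$, $\kappa_n=\mathcal H^n(B)$, where $\mathcal H^n$ is Lebesgue measure. For a non-empty compact convex set $K\subset\mathbb R^n$ the quermassintegrals $W_0(K),\dots,W_n(K)$ are the coefficients in the expansion $$\mathcal H^n(K+\rho B)=\sum_{i=0}^n\binom ni W_i(K)\,\rho^i\qquad(\rho\ge 0),$$ and $W_i(\emptyset)=0$. Let $f:\mathbb R^n\to[0,+\infty]$ be not identically zero, quasi-concave, upper semicontinuous, with $\lim_{\|x\|\to\infty}f(x)=0$, and log-concave, i.e. $f((1-\lambda)x+\lambda y)\ge f(x)^{1-\lambda}f(y)^{\lambda}$ for all $\lambda\in(0,1)$ and all $x,y$ with $f(x),f(y)>0$ (that is, $f\in\mathcal Q^n_0$). For $\rho>0$ put $$(\chi_B\oplus\rho\cdot f)(z)=\sup\{\chi_B(x)\,f(y)^\rho:\ z=x+\rho y\},\qquad \Psi(\rho)=\int_{\mathbb R^n}(\chi_B\oplus\rho\cdot f)(z)\,dz\in[0,+\infty],$$ and $\Psi(0)=\int\chi_B=\kappa_n$ (the same expression at $\rho=0$, with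 $f(y)^0=1$). Theorem 3.6 (Dual Steiner-type formula). For every $\rho>0$, as an identity in $[0,+\infty]$, $$\Psi(\rho)=\sum_{j=0}^n\binom nj\rho^{\,j+1}\int_0^{+\infty}W_{n-j}\big(\mathrm{cl}\{f>t\}\big)\,t^{\rho-1}\,dt .$$ Moreover the maximum $\max f\in(0,+\infty]$ is attained and, denoting by $K_f=\mathrm{cl}\{f>0\}$ the support of $f$, the limit $\Psi'(0^+)=\lim_{\rho\to0^+}\frac{\Psi(\rho)-\Psi(0)}{\rho}$ exists in the extended reals and $$\Psi'(0^+)=\begin{cases}\kappa_n\log(\max f)+n\,W_{n-1}(K_f), & \text{if }K_f\text{ is compact},\\ +\infty, & \text{otherwise},\end{cases}$$ where $\log(+\infty)=+\infty$. -/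

import Mathlib

open Set Filter Topology MeasureTheory
open scoped ENNReal Pointwise

/-- The closed Euclidean unit ball `B` of `ℝⁿ`. -/
def unitBall (n : ℕ) : Set (EuclideanSpace ℝ (Fin n)) :=
  Metric.closedBall 0 1

/-- The volume `κₙ` of the unit ball of `ℝⁿ`. -/
noncomputable def ballVolume (n : ℕ) : ℝ :=
  volume.real (unitBall n)

/-- `W 0, …, W n` are the normalised coefficients of the polynomial expansion
`ℋⁿ(K + ρ B) = ∑_{i ≤ n} (n choose i) Wᵢ ρⁱ`, `ρ ≥ 0` (the entries `W i` with `i > n` do not occur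
in the expansion and are set to zero). -/
def IsSteinerExpansion (n : ℕ) (K : Set (EuclideanSpace ℝ (Fin n))) (W : ℕ → ℝ) : Prop :=
  (∀ ρ : ℝ, 0 ≤ ρ →
    volume.real (K + ρ • unitBall n) = ∑ i ∈ Finset.range (n + 1), (n.choose i : ℝ) * W i * ρ ^ i) ∧
  ∀ i, n < i → W i = 0

/-- The coefficients of the expansion are determined by the set. -/
theorem IsSteinerExpansion.unique {n : ℕ} {K : Set (EuclideanSpace ℝ (Fin n))} {W W' : ℕ → ℝ}
    (h : IsSteinerExpansion n K W) (h' : IsSteinerExpansion n K W') : W = W' := by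
  have key : (∑ i ∈ Finset.range (n + 1), Polynomial.monomial i ((n.choose i : ℝ) * W i)) =
      ∑ i ∈ Finset.range (n + 1), Polynomial.monomial i ((n.choose i : ℝ) * W' i) := by
    apply Polynomial.eq_of_infinite_eval_eq
    refine (Set.Ici_infinite (0 : ℝ)).mono fun ρ hρ => ?_
    have := (h.1 ρ hρ).symm.trans (h'.1 ρ hρ)
    simpa [Polynomial.eval_finsetSum, Polynomial.eval_monomial] using this
  funext i
  rcases lt_or_ge n i with hi | hi
  · rw [h.2 i hi, h'.2 i hi]
  · have hc := congrArg (fun p => Polynomial.coeff p i) key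
    have hi' : i < n + 1 := by omega
    have hpos : (n.choose i : ℝ) ≠ 0 := by exact_mod_cast (Nat.choose_pos hi).ne'
    simpa [Polynomial.finsetSum_coeff, Polynomial.coeff_monomial, hi', hpos,
      Nat.not_lt.mpr hi, Nat.not_lt.mpr (Nat.succ_le_succ hi), (Nat.choose_pos hi).ne'] using hc

open Classical in
/-- The `i`-th quermassintegral `Wᵢ(K)` of a compact convex set `K ⊆ ℝⁿ`: the coefficient `Wᵢ` of
the polynomial expansion of `ρ ↦ ℋⁿ(K + ρ B)`. For `K = ∅` all of them are zero; on sets without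
such an expansion the value is irrelevant. -/
noncomputable def quermassintegral {n : ℕ} (i : ℕ) (K : Set (EuclideanSpace ℝ (Fin n))) : ℝ :=
  if h : ∃ W, IsSteinerExpansion n K W then h.choose i else 0

/-- The class `𝒬ⁿ`: functions `ℝⁿ → [0, ∞]`, not identically zero, quasi-concave, upper
semicontinuous, vanishing at infinity. -/
structure IsClassQ {n : ℕ} (f : EuclideanSpace ℝ (Fin n) → ℝ≥0∞) : Prop where
  ne_zero : ∃ x, f x ≠ 0
  quasiconcave : QuasiconcaveOn ℝ univ f
  upperSemicontinuous : UpperSemicontinuous f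
  vanishing : Tendsto f (cocompact (EuclideanSpace ℝ (Fin n))) (𝓝 0)

/-- Log-concavity of a function `ℝⁿ → [0, ∞]`. Only points where `f` is positive are compared, and
`∞ ^ a * v = ∞` for `a > 0`, `v > 0`. -/
def IsLogConcave {n : ℕ} (f : EuclideanSpace ℝ (Fin n) → ℝ≥0∞) : Prop :=
  ∀ x y, 0 < f x → 0 < f y → ∀ lam : ℝ, 0 < lam → lam < 1 →
    f x ^ (1 - lam) * f y ^ lam ≤ f ((1 - lam) • x + lam • y)

/-- The class `𝒬ⁿ₀` of the log-concave functions in `𝒬ⁿ`. -/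
structure IsClassQLog {n : ℕ} (f : EuclideanSpace ℝ (Fin n) → ℝ≥0∞) : Prop
    extends IsClassQ f where
  logConcave : IsLogConcave f

/-- The combination `s · f ⊕ t · g` in the class of log-concave functions,
`z ↦ sup {f(x)ˢ g(y)ᵗ : z = s x + t y}`. -/
noncomputable def logSum {n : ℕ} (s t : ℝ) (f g : EuclideanSpace ℝ (Fin n) → ℝ≥0∞)
    (z : EuclideanSpace ℝ (Fin n)) : ℝ≥0∞ :=
  ⨆ (x : EuclideanSpace ℝ (Fin n)) (y : EuclideanSpace ℝ (Fin n)) (_ : z = s • x + t • y),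
    f x ^ s * g y ^ t

/-- The characteristic function `χ_B` of the unit ball. -/
noncomputable def ballIndicator (n : ℕ) : EuclideanSpace ℝ (Fin n) → ℝ≥0∞ :=
  (unitBall n).indicator 1

/-- `Ψ(ρ) = I(χ_B ⊕ ρ · f)`. For `ρ = 0` and `f` not identically zero this is `I(χ_B) = κₙ`. -/
noncomputable def dualPsi {n : ℕ} (f : EuclideanSpace ℝ (Fin n) → ℝ≥0∞) (ρ : ℝ) : ℝ≥0∞ :=
  ∫⁻ z, logSum 1 ρ (ballIndicator n) f z

/-- The closed superlevel set `cl {f > t}`, `t ≥ 0`. For `t = 0` it is the support of `f`. -/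
def closedSuperlevel {n : ℕ} (f : EuclideanSpace ℝ (Fin n) → ℝ≥0∞) (t : ℝ) :
    Set (EuclideanSpace ℝ (Fin n)) :=
  closure {x | ENNReal.ofReal t < f x}

/-- The support `K_f = cl {f > 0}`. -/
def fnSupport {n : ℕ} (f : EuclideanSpace ℝ (Fin n) → ℝ≥0∞) : Set (EuclideanSpace ℝ (Fin n)) :=
  closure {x | 0 < f x}

/-! Steiner's formula for the ball comes first. Adding a segment to a convex body changes volume
affinely in the length, with a multiple of a projection's volume as slope (Fubini along the
segment). Induction on the number of segments makes the volume of `K + ρZ` a polynomial in ρ with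
nonnegative coefficients for every zonotope `Z`. The ball is a limit of zonotopes, and polynomials
of bounded degree converge coefficientwise once their values converge, so degree and signs survive
in the limit.

The dual formula is then a layer-cake identity. The set where the sup-convolution exceeds `t ^ ρ` is
exactly `B + ρ{f > t}`, so for finite `max f` one has Ψ(ρ) = ρ ∫ t^(ρ-1) |B + ρ{f > t}| dt. Closing
`{f > t}` does not change the volume, and Steiner's formula read backwards (`B + ρK = ρ(K + ρ⁻¹B)`)
expands the integrand. If `max f = ∞`, both sides are infinite.

For the derivative put m = max f < ∞. If |B + ρ{f > s}| ≥ κ + ρA, the layer cake gives Ψ(ρ) ≥ κ m^ρ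
+ ρ A s^ρ, hence a lower bound κ log m + A for the difference quotient in the limit. For compact
support, A = n W_{n-1}(cl{f > s}) tends to n W_{n-1}(K_f) as s → 0, and Ψ(ρ) ≤ m^ρ |B + ρK_f| gives
the matching upper bound. For unbounded support, superlevel sets contain arbitrarily long segments,
so A can be taken arbitrarily large. -/

/-! ### Polynomials of bounded degree and limits of their coefficients -/

/-- `g` agrees on `[0, ∞)` with a polynomial of degree at most `d` with nonnegative coefficients
`a`. -/
def IsNonnegExpansion (d : ℕ) (g : ℝ → ℝ) (a : ℕ → ℝ) : Prop :=
  (∀ i, 0 ≤ a i) ∧ ∀ ρ : ℝ, 0 ≤ ρ → g ρ = ∑ i ∈ Finset.range (d + 1), a i * ρ ^ i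

/-- The coefficients of a polynomial of degree at most `d` are fixed linear combinations of its
values at `0, …, d`. -/
theorem exists_interpolation_weights (d : ℕ) : ∃ c : ℕ → ℕ → ℝ, ∀ a : ℕ → ℝ, ∀ i ≤ d,
    a i = ∑ k ∈ Finset.range (d + 1), c i k * ∑ j ∈ Finset.range (d + 1), a j * (k : ℝ) ^ j := by
  refine ⟨fun i k => (Lagrange.basis (Finset.range (d + 1)) (fun k : ℕ => (k : ℝ)) k).coeff i,
    fun a i hi => ?_⟩
  set p : Polynomial ℝ := ∑ j ∈ Finset.range (d + 1), Polynomial.monomial j (a j) with hp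
  have hdeg : p.degree < (Finset.range (d + 1)).card := by
    rw [Finset.card_range, hp]
    refine (Polynomial.degree_sum_le _ _).trans_lt ?_
    rw [Finset.sup_lt_iff (by exact WithBot.bot_lt_coe _)]
    intro j hj
    exact (Polynomial.degree_monomial_le _ _).trans_lt
      (by exact_mod_cast (Finset.mem_range.1 hj))
  have hint := Lagrange.eq_interpolate (s := Finset.range (d + 1)) (v := fun k : ℕ => (k : ℝ))
    (f := p) (Nat.cast_injective.injOn) hdeg
  have h1 : p.coeff i = a i := by
    simp [hp, Polynomial.finsetSum_coeff, Polynomial.coeff_monomial, Nat.lt_succ_of_le hi]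
  rw [← h1, hint, Lagrange.interpolate_apply, Polynomial.finsetSum_coeff]
  refine Finset.sum_congr rfl fun k _ => ?_
  rw [Polynomial.coeff_C_mul, mul_comm]
  congr 1
  simp [hp, Polynomial.eval_finsetSum]

theorem IsNonnegExpansion.tendsto_coeff {ι : Type*} {l : Filter ι} {d : ℕ} {g : ι → ℝ → ℝ}
    {g₀ : ℝ → ℝ} {a : ι → ℕ → ℝ} (h : ∀ k, IsNonnegExpansion d (g k) (a k))
    (hg : ∀ ρ, 0 ≤ ρ → Tendsto (fun k => g k ρ) l (𝓝 (g₀ ρ))) :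
    ∃ b : ℕ → ℝ, ∀ i ≤ d, Tendsto (fun k => a k i) l (𝓝 (b i)) := by
  obtain ⟨c, hc⟩ := exists_interpolation_weights d
  refine ⟨fun i => ∑ k ∈ Finset.range (d + 1), c i k * g₀ k, fun i hi => ?_⟩
  have : (fun k => a k i) = fun k => ∑ m ∈ Finset.range (d + 1), c i m * g k m := by
    funext k
    rw [hc (a k) i hi]
    refine Finset.sum_congr rfl fun m _ => ?_
    rw [(h k).2 m (Nat.cast_nonneg m)]
  rw [this]
  exact tendsto_finsetSum _ fun m _ => (hg m (Nat.cast_nonneg m)).const_mul _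

theorem IsNonnegExpansion.limit {ι : Type*} {l : Filter ι} [l.NeBot] {d : ℕ} {g : ι → ℝ → ℝ}
    {g₀ : ℝ → ℝ} {a : ι → ℕ → ℝ} (h : ∀ k, IsNonnegExpansion d (g k) (a k))
    (hg : ∀ ρ, 0 ≤ ρ → Tendsto (fun k => g k ρ) l (𝓝 (g₀ ρ))) :
    ∃ b : ℕ → ℝ, IsNonnegExpansion d g₀ b ∧
      ∀ i ≤ d, Tendsto (fun k => a k i) l (𝓝 (b i)) := by
  obtain ⟨b, hb⟩ := IsNonnegExpansion.tendsto_coeff h hg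
  -- Convergence says nothing about `b i` for `i > d`, so these entries are reset to zero to keep
  -- all coefficients nonnegative.
  refine ⟨fun i => if i ≤ d then b i else 0, ⟨fun i => ?_, fun ρ hρ => ?_⟩, fun i hi => ?_⟩
  · dsimp only
    split_ifs with hi
    · exact ge_of_tendsto' (hb i hi) fun k => (h k).1 i
    · exact le_rfl
  · refine tendsto_nhds_unique (hg ρ hρ) ?_
    simp_rw [fun k => (h k).2 ρ hρ]
    refine tendsto_finsetSum _ fun i hi => ?_
    have hi' : i ≤ d := Nat.lt_succ_iff.1 (Finset.mem_range.1 hi)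
    simpa only [if_pos hi'] using (hb i hi').mul_const _
  · simpa only [if_pos hi] using hb i hi

/-! ### Zonotopes and the Steiner formula for them -/

section Zonotope

variable {E F : Type*} [NormedAddCommGroup E] [NormedSpace ℝ E] [NormedAddCommGroup F]
  [NormedSpace ℝ F]

/-- The segment `[-u, u]`. -/
def symmSegment (u : E) : Set E := (fun t : ℝ => t • u) '' Icc (-1) 1

/-- The Minkowski sum of the segments `[-u, u]` for `u` in a list. -/
def zonotope : List E → Set E
  | [] => {0}
  | u :: l => symmSegment u + zonotope l

theorem isCompact_symmSegment (u : E) : IsCompact (symmSegment u) :=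
  isCompact_Icc.image (by fun_prop)

theorem convex_symmSegment (u : E) : Convex ℝ (symmSegment u) :=
  (convex_Icc (-1 : ℝ) 1).is_linear_image (LinearMap.toSpanSingleton ℝ E u).isLinear

theorem image_symmSegment (A : E →ₗ[ℝ] F) (u : E) :
    A '' symmSegment u = symmSegment (A u) := by
  simp [symmSegment, image_image]

theorem isCompact_zonotope (l : List E) : IsCompact (zonotope l) := by
  induction l with
  | nil => exact isCompact_singleton
  | cons u l ih => exact (isCompact_symmSegment u).add ih

theorem convex_zonotope (l : List E) : Convex ℝ (zonotope l) := by
  induction l with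
  | nil => exact convex_singleton 0
  | cons u l ih => exact (convex_symmSegment u).add ih

theorem image_zonotope (A : E →ₗ[ℝ] F) (l : List E) :
    A '' zonotope l = zonotope (l.map A) := by
  induction l with
  | nil => simp [zonotope]
  | cons u l ih => rw [zonotope, image_add, ih, image_symmSegment]; rfl

end Zonotope

theorem volume_Icc_section_add {s : Set ℝ} (hs : IsCompact s) (hc : Convex ℝ s) (hne : s.Nonempty)
    {r : ℝ} (hr : 0 ≤ r) : volume (s + Icc (-r) r) = volume s + ENNReal.ofReal (2 * r) := by
  have hs' : s = Icc (sInf s) (sSup s) :=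
    eq_Icc_of_connected_compact ⟨hne, hc.isPreconnected⟩ hs
  have hle : sInf s ≤ sSup s := Real.sInf_le_sSup s hs.bddBelow hs.bddAbove
  set a := sInf s
  set b := sSup s
  rw [hs', Icc_add_Icc hle (by linarith), Real.volume_Icc, Real.volume_Icc,
    ← ENNReal.ofReal_add (by linarith) (by linarith)]
  congr 1; ring

theorem volume_eq_lintegral_section {m : ℕ} {S : Set (Fin (m + 1) → ℝ)} (hS : MeasurableSet S) :
    volume S = ∫⁻ y : Fin m → ℝ, volume {x : ℝ | Fin.cons (α := fun _ => ℝ) x y ∈ S} := by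
  have hmp := (volume_preserving_piFinSuccAbove (fun _ : Fin (m + 1) => ℝ) 0).symm
  rw [← hmp.measure_preimage hS.nullMeasurableSet, Measure.volume_eq_prod,
    Measure.prod_apply_symm (hmp.measurable hS)]
  refine lintegral_congr fun y => ?_
  congr 1
  ext x
  simp [MeasurableEquiv.piFinSuccAbove, Fin.insertNthEquiv]

/-- Fubini in the first coordinate: over each point of the projection the section of `K` is a
nonempty compact interval, which the segment lengthens by `2 * r`; over all other points both
sections are empty. -/
theorem volume_add_coordinate_segment {m : ℕ} {K : Set (Fin (m + 1) → ℝ)} (hK : IsCompact K)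
    (hc : Convex ℝ K) {r : ℝ} (hr : 0 ≤ r) :
    volume (K + r • symmSegment (Pi.single 0 1 : Fin (m + 1) → ℝ)) =
      volume K + ENNReal.ofReal (2 * r) *
        volume (LinearMap.funLeft ℝ ℝ (Fin.succ : Fin m → Fin (m + 1)) '' K) := by
  set P := LinearMap.funLeft ℝ ℝ (Fin.succ : Fin m → Fin (m + 1))
  have hPK : IsCompact (P '' K) := hK.image P.continuous_of_finiteDimensional
  have hsum : IsCompact (K + r • symmSegment (Pi.single 0 1 : Fin (m + 1) → ℝ)) :=
    hK.add ((isCompact_symmSegment _).smul r)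
  have hcons : ∀ (x : ℝ) (y : Fin m → ℝ), P (Fin.cons (α := fun _ => ℝ) x y) = y := by
    intro x y; ext i; simp [P, LinearMap.funLeft]
  rw [volume_eq_lintegral_section hsum.measurableSet, volume_eq_lintegral_section hK.measurableSet,
    ← lintegral_indicator_one hPK.measurableSet,
    ← lintegral_const_mul _ (measurable_one.indicator hPK.measurableSet), ← lintegral_add_right _
      ((measurable_one.indicator hPK.measurableSet).const_mul _)]
  refine lintegral_congr fun y => ?_
  have hsec : {x : ℝ | Fin.cons (α := fun _ => ℝ) x y ∈
      K + r • symmSegment (Pi.single 0 1 : Fin (m + 1) → ℝ)} =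
      {x : ℝ | Fin.cons (α := fun _ => ℝ) x y ∈ K} + Icc (-r) r := by
    ext x
    simp only [mem_ofPred_eq, Set.mem_add]
    constructor
    · rintro ⟨k, hk, _, ⟨_, ⟨t, ht, rfl⟩, rfl⟩, h⟩
      refine ⟨x - r * t, ?_, r * t, ⟨by nlinarith [ht.1], by nlinarith [ht.2]⟩, by ring⟩
      convert hk using 1
      ext i
      have hi := congrFun h i
      revert hi
      refine Fin.cases ?_ (fun j => ?_) i <;> intro hi <;> simp at hi ⊢ <;> linarith
    · rintro ⟨x', hx', s, hs, rfl⟩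
      rcases hr.eq_or_lt with rfl | hr'
      · refine ⟨_, hx', 0, ⟨0, ⟨0, by simp, by simp⟩, by simp⟩, ?_⟩
        have : s = 0 := by linarith [hs.1, hs.2]
        simp [this]
      · refine ⟨_, hx', s • Pi.single 0 1, ⟨(s / r) • Pi.single 0 1, ⟨s / r, ⟨?_, ?_⟩, rfl⟩, ?_⟩, ?_⟩
        · rw [le_div_iff₀ hr']; linarith [hs.1]
        · rw [div_le_iff₀ hr']; linarith [hs.2]
        · simp only [smul_smul]; congr 1; field_simp
        · ext i
          refine Fin.cases ?_ (fun j => ?_) i <;> simp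
  rw [hsec]
  by_cases hy : y ∈ P '' K
  · have hne : {x : ℝ | Fin.cons (α := fun _ => ℝ) x y ∈ K}.Nonempty := by
      obtain ⟨k, hk, rfl⟩ := hy
      refine ⟨k 0, ?_⟩
      have : (Fin.cons (α := fun _ => ℝ) (k 0) (P k) : Fin (m + 1) → ℝ) = k := by
        ext i; refine Fin.cases ?_ (fun j => ?_) i <;> simp [P, LinearMap.funLeft]
      simpa [this] using hk
    have hcl : IsCompact {x : ℝ | Fin.cons (α := fun _ => ℝ) x y ∈ K} := by
      have hcont : Continuous fun x : ℝ => (Fin.cons (α := fun _ => ℝ) x y : Fin (m + 1) → ℝ) :=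
        continuous_pi fun i => by refine Fin.cases ?_ (fun j => ?_) i <;> simp <;> fun_prop
      refine Metric.isCompact_of_isClosed_isBounded (hK.isClosed.preimage hcont) ?_
      refine (hK.image (continuous_apply (0 : Fin (m + 1)))).isBounded.subset ?_
      exact fun x hx => ⟨_, hx, by simp⟩
    have hcv : Convex ℝ {x : ℝ | Fin.cons (α := fun _ => ℝ) x y ∈ K} := by
      intro x hx x' hx' a b ha hb hab
      have := hc hx hx' ha hb hab
      rw [mem_ofPred_eq]
      convert this using 1
      ext i
      refine Fin.cases ?_ (fun j => ?_) i
      · simp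
      · simp [← add_mul, hab]
    rw [volume_Icc_section_add hcl hcv hne hr, indicator_of_mem hy]
    simp
  · have hemp : {x : ℝ | Fin.cons (α := fun _ => ℝ) x y ∈ K} = ∅ := by
      rw [eq_empty_iff_forall_notMem]
      exact fun x hx => hy ⟨_, hx, hcons x y⟩
    simp [hemp, hy]

/-- Adding a multiple of a segment changes the volume of a convex body linearly, with the volume of
a projection as slope. -/
theorem exists_volume_add_smul_symmSegment {m : ℕ} (u : Fin (m + 1) → ℝ) :
    ∃ (P : (Fin (m + 1) → ℝ) →ₗ[ℝ] (Fin m → ℝ)) (c : ℝ), 0 ≤ c ∧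
      ∀ K : Set (Fin (m + 1) → ℝ), IsCompact K → Convex ℝ K → ∀ r : ℝ, 0 ≤ r →
        volume.real (K + r • symmSegment u) = volume.real K + r * c * volume.real (P '' K) := by
  by_cases hu : u = 0
  · refine ⟨0, 0, le_rfl, fun K _ _ r _ => ?_⟩
    have : symmSegment u = {0} := by
      subst hu; simp [symmSegment]
    simp [this]
  -- A linear automorphism taking `u` to the first basis vector reduces to the coordinate segment.
  -- Volumes scale by `D = |det A|`, whence the slope constant `2 / D`.
  · obtain ⟨A, hA⟩ := SeparatingDual.exists_continuousLinearEquiv_apply_eq (R := ℝ) hu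
      (y := (Pi.single 0 1 : Fin (m + 1) → ℝ)) (by simp)
    have hdet : LinearMap.det (A : (Fin (m + 1) → ℝ) →ₗ[ℝ] (Fin (m + 1) → ℝ)) ≠ 0 :=
      (LinearEquiv.isUnit_det' A.toLinearEquiv).ne_zero
    set D := |LinearMap.det (A : (Fin (m + 1) → ℝ) →ₗ[ℝ] (Fin (m + 1) → ℝ))| with hD
    have hDpos : 0 < D := abs_pos.2 hdet
    have himg : ∀ S : Set (Fin (m + 1) → ℝ), volume.real (A '' S) = D * volume.real S := by
      intro S
      have := congrArg ENNReal.toReal (Measure.addHaar_image_linearMap volume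
        (A : (Fin (m + 1) → ℝ) →ₗ[ℝ] (Fin (m + 1) → ℝ)) S)
      rw [ENNReal.toReal_mul, ENNReal.toReal_ofReal (abs_nonneg _)] at this
      exact this
    refine ⟨LinearMap.funLeft ℝ ℝ (Fin.succ : Fin m → Fin (m + 1)) ∘ₗ
      (A : (Fin (m + 1) → ℝ) →ₗ[ℝ] (Fin (m + 1) → ℝ)), 2 / D, by positivity,
      fun K hK hc r hr => ?_⟩
    have hAK : IsCompact (A '' K) := hK.image A.continuous
    have hAc : Convex ℝ (A '' K) := hc.linear_image (A : (Fin (m + 1) → ℝ) →ₗ[ℝ] (Fin (m + 1) → ℝ))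
    have key := volume_add_coordinate_segment hAK hAc hr
    have hsum : A '' (K + r • symmSegment u) = A '' K + r • symmSegment (Pi.single 0 1) := by
      rw [← hA, image_add, image_smul_set]
      congr 2
      exact image_symmSegment (A : (Fin (m + 1) → ℝ) →ₗ[ℝ] (Fin (m + 1) → ℝ)) u
    have hfin : volume (LinearMap.funLeft ℝ ℝ (Fin.succ : Fin m → Fin (m + 1)) '' (A '' K)) ≠ ⊤ :=
      (hAK.image (LinearMap.continuous_of_finiteDimensional _)).measure_ne_top
    have key' := congrArg ENNReal.toReal key
    rw [← hsum, ENNReal.toReal_add hAK.measure_ne_top (ENNReal.mul_ne_top ENNReal.ofReal_ne_top hfin),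
      ENNReal.toReal_mul, ENNReal.toReal_ofReal (by positivity)] at key'
    simp only [← measureReal_def, himg] at key'
    have himg2 : (LinearMap.funLeft ℝ ℝ (Fin.succ : Fin m → Fin (m + 1)) ∘ₗ
        (A : (Fin (m + 1) → ℝ) →ₗ[ℝ] (Fin (m + 1) → ℝ))) '' K =
        LinearMap.funLeft ℝ ℝ (Fin.succ : Fin m → Fin (m + 1)) '' (A '' K) := by
      rw [image_image]; rfl
    rw [himg2]
    have hD' := hDpos.ne'
    apply mul_left_cancel₀ hD'
    rw [key']
    field_simp

/-- The Steiner formula with a zonotope in place of the ball. -/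
theorem exists_isNonnegExpansion_zonotope {n : ℕ} (l : List (Fin n → ℝ)) :
    ∀ K : Set (Fin n → ℝ), IsCompact K → Convex ℝ K →
      ∃ a, IsNonnegExpansion n (fun ρ => volume.real (K + ρ • zonotope l)) a := by
  -- The dimension must vary in the induction on the number of segments: splitting off one segment
  -- produces a projected zonotope one dimension lower.
  suffices H : ∀ N : ℕ, ∀ n, ∀ l : List (Fin n → ℝ), l.length = N →
      ∀ K : Set (Fin n → ℝ), IsCompact K → Convex ℝ K →
      ∃ a, IsNonnegExpansion n (fun ρ => volume.real (K + ρ • zonotope l)) a from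
    H _ n l rfl
  intro N
  induction N with
  | zero =>
    intro n l hl K hK hc
    obtain rfl := List.length_eq_zero_iff.1 hl
    refine ⟨fun i => if i = 0 then volume.real K else 0, fun i => ?_, fun ρ hρ => ?_⟩
    · dsimp only; split_ifs <;> simp
    · simp [zonotope, Finset.sum_ite_eq']
  | succ N ih =>
    intro n l hl K hK hc
    obtain ⟨u, l, rfl⟩ : ∃ u l', l = u :: l' := List.exists_cons_of_length_eq_add_one hl
    have hl' : l.length = N := by simpa using hl
    obtain ⟨a, ha, haK⟩ := ih n l hl' K hK hc
    -- In dimension zero there is nothing to project along, but every segment is a point.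
    rcases n with _ | m
    · refine ⟨a, ha, fun ρ hρ => ?_⟩
      rw [← haK ρ hρ]
      have : u = 0 := Subsingleton.elim _ _
      have hz : symmSegment (0 : Fin 0 → ℝ) = {0} := by
        simp only [symmSegment, smul_zero]
        exact Nonempty.image_const ⟨0, by simp⟩ _
      simp only [zonotope, this, hz, Set.singleton_add, zero_add, image_id']
    · obtain ⟨P, c, hc0, hP⟩ := exists_volume_add_smul_symmSegment u
      obtain ⟨b, hb, hbK⟩ := ih m (l.map P) (by simpa using hl') (P '' K)
        (hK.image P.continuous_of_finiteDimensional) (hc.linear_image P)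
      -- The slope of the new segment carries a factor ρ, so the coefficients `b` of the projected
      -- body enter shifted by one degree.
      refine ⟨fun i => a i + c * (if i = 0 then 0 else b (i - 1)), fun i => ?_, fun ρ hρ => ?_⟩
      · have := ha i
        have := hb (i - 1)
        dsimp only; split_ifs <;> positivity
      · have e : K + ρ • zonotope (u :: l) = (K + ρ • zonotope l) + ρ • symmSegment u := by
          rw [zonotope, smul_add]; abel
        have e2 : P '' (K + ρ • zonotope l) = P '' K + ρ • zonotope (l.map P) := by
          rw [image_add, image_smul_set, image_zonotope]
        have hk := haK ρ hρ
        have hk2 := hbK ρ hρ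
        dsimp only at hk hk2 ⊢
        rw [e, hP _ (hK.add ((isCompact_zonotope l).smul ρ))
          (hc.add ((convex_zonotope l).smul ρ)) ρ hρ, e2, hk, hk2]
        simp only [add_mul, Finset.sum_add_distrib, add_right_inj]
        rw [Finset.sum_range_succ' (fun i => c * (if i = 0 then 0 else b (i - 1)) * ρ ^ i)]
        simp only [Finset.mul_sum]
        simp [pow_succ]
        exact Finset.sum_congr rfl fun i _ => by ring

/-! ### Approximating the unit ball by zonotopes through support functions -/

section Inner

variable {E : Type*} [NormedAddCommGroup E] [InnerProductSpace ℝ E]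

theorem inner_le_of_mem_zonotope {l : List E} {x : E} (hx : x ∈ zonotope l) (v : E) :
    inner ℝ x v ≤ (l.map fun u => |inner ℝ u v|).sum := by
  induction l generalizing x with
  | nil => simp_all [zonotope]
  | cons u l ih =>
    obtain ⟨_, ⟨t, ht, rfl⟩, z, hz, rfl⟩ := hx
    have h1 := ih hz
    have h2 : t * inner ℝ u v ≤ |inner ℝ u v| := by
      refine (le_abs_self _).trans ?_
      rw [abs_mul]
      exact mul_le_of_le_one_left (abs_nonneg _) (abs_le.2 ht)
    simp only [List.map_cons, List.sum_cons, inner_add_left, inner_smul_left]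
    simp only [conj_trivial]
    linarith

/-- Choosing in each segment the endpoint on the positive side of `v` attains the preceding bound,
so the sum is the support function of the zonotope. -/
theorem exists_mem_zonotope_inner_eq (l : List E) (v : E) :
    ∃ x ∈ zonotope l, inner ℝ x v = (l.map fun u => |inner ℝ u v|).sum := by
  induction l with
  | nil => exact ⟨0, rfl, by simp⟩
  | cons u l ih =>
    obtain ⟨z, hz, hzv⟩ := ih
    rcases le_total 0 (inner ℝ u v) with h | h
    · refine ⟨_, ⟨_, ⟨1, by simp, rfl⟩, z, hz, rfl⟩, ?_⟩
      simp [inner_add_left, hzv, abs_of_nonneg h]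
    · refine ⟨_, ⟨_, ⟨-1, by simp, rfl⟩, z, hz, rfl⟩, ?_⟩
      simp [inner_add_left, hzv, abs_of_nonpos h]

theorem zonotope_subset_closedBall {l : List E} {R : ℝ} (hR : 0 ≤ R)
    (h : ∀ v : E, (l.map fun u => |inner ℝ u v|).sum ≤ R * ‖v‖) :
    zonotope l ⊆ Metric.closedBall 0 R := by
  intro x hx
  have h1 := (inner_le_of_mem_zonotope hx x).trans (h x)
  rw [real_inner_self_eq_norm_mul_norm] at h1
  rw [mem_closedBall_zero_iff]
  rcases (norm_nonneg x).eq_or_lt with h0 | h0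
  · exact h0 ▸ hR
  · exact le_of_mul_le_mul_right h1 h0

/-- A point of the ball outside the zonotope would be strictly separated from it by some `v`, along
which the zonotope's support function would fall below `R * ‖v‖`. -/
theorem closedBall_subset_zonotope [CompleteSpace E] {l : List E} {R : ℝ}
    (h : ∀ v : E, R * ‖v‖ ≤ (l.map fun u => |inner ℝ u v|).sum) :
    Metric.closedBall 0 R ⊆ zonotope l := by
  intro x hx
  by_contra hxZ
  obtain ⟨φ, s, h1, h2⟩ := geometric_hahn_banach_closed_point (convex_zonotope l)
    (isCompact_zonotope l).isClosed hxZ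
  obtain ⟨v, rfl⟩ := (InnerProductSpace.toDual ℝ E).surjective φ
  simp only [InnerProductSpace.toDual_apply_apply] at h1 h2
  obtain ⟨z, hz, hzv⟩ := exists_mem_zonotope_inner_eq l v
  have h3 := h1 z hz
  rw [real_inner_comm, hzv] at h3
  have h4 := real_inner_le_norm v x
  have h5 := h v
  have h6 := mul_le_mul_of_nonneg_left (mem_closedBall_zero_iff.1 hx) (norm_nonneg v)
  nlinarith

variable [FiniteDimensional ℝ E] [MeasurableSpace E] [BorelSpace E]

/-- The reflection exchanging two vectors of equal norm preserves both volume and the ball. -/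
theorem setIntegral_abs_inner_eq_of_norm_eq {v w : E} (h : ‖v‖ = ‖w‖) :
    ∫ u in Metric.closedBall (0 : E) 1, |inner ℝ u v| =
      ∫ u in Metric.closedBall (0 : E) 1, |inner ℝ u w| := by
  set T := (ℝ ∙ (v - w))ᗮ.reflection with hT
  have hTv : T v = w := Submodule.reflection_sub h
  have hmp : MeasurePreserving T := T.measurePreserving
  have key := hmp.setIntegral_preimage_emb T.toHomeomorph.measurableEmbedding
    (fun u => |inner ℝ u w|) (Metric.closedBall 0 1)
  have : T ⁻¹' Metric.closedBall (0 : E) 1 = Metric.closedBall 0 1 := by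
    rw [LinearIsometryEquiv.preimage_closedBall, map_zero]
  rw [this] at key
  rw [← key]
  refine integral_congr_ae (ae_of_all _ fun u => ?_)
  dsimp only
  rw [← hTv, LinearIsometryEquiv.inner_map_map]

/-- By rotation invariance and homogeneity the averaged support function of segments is a multiple
of the norm, the support function of the ball. The multiple is positive because the integrand is at
least 1/4 on the ball of radius 1/4 around `e / 2`. -/
theorem exists_setIntegral_abs_inner_eq [Nontrivial E] :
    ∃ c : ℝ, 0 < c ∧
      ∀ v : E, ∫ u in Metric.closedBall (0 : E) 1, |inner ℝ u v| = c * ‖v‖ := by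
  obtain ⟨e, he⟩ := exists_norm_eq E zero_le_one
  refine ⟨∫ u in Metric.closedBall (0 : E) 1, |inner ℝ u e|, ?_, fun v => ?_⟩
  · have hcont : Continuous fun u : E => |inner ℝ u e| := by fun_prop
    rw [setIntegral_pos_iff_support_of_nonneg_ae (ae_of_all _ fun _ => abs_nonneg _)
      (hcont.continuousOn.integrableOn_compact (isCompact_closedBall _ _))]
    refine (Metric.measure_ball_pos volume ((1 / 2 : ℝ) • e) (r := 1 / 4) (by norm_num)).trans_le
      (measure_mono fun u hu => ?_)
    rw [Metric.mem_ball, dist_eq_norm] at hu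
    have hdec : u = (1 / 2 : ℝ) • e + (u - (1 / 2 : ℝ) • e) := by abel
    constructor
    · have h1 : inner ℝ u e = 1 / 2 + inner ℝ (u - (1 / 2 : ℝ) • e) e := by
        conv_lhs => rw [hdec, inner_add_left, inner_smul_left, real_inner_self_eq_norm_sq, he]
        simp
      have h2 := abs_real_inner_le_norm (u - (1 / 2 : ℝ) • e) e
      rw [he, mul_one] at h2
      have h3 := (abs_le.1 h2).1
      simp only [Function.mem_support, ne_eq, abs_eq_zero]
      linarith
    · rw [mem_closedBall_zero_iff, hdec]
      refine (norm_add_le _ _).trans ?_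
      rw [norm_smul, he]
      norm_num
      linarith
  · have h1 : ‖v‖ = ‖‖v‖ • e‖ := by simp [norm_smul, he]
    rw [setIntegral_abs_inner_eq_of_norm_eq h1, mul_comm, ← integral_const_mul]
    simp [inner_smul_right, abs_mul]

/-- The unit ball is a zonoid: it is a limit of zonotopes. -/
theorem exists_zonotope_approx_closedBall [Nontrivial E] {ε : ℝ} (hε : 0 < ε) :
    ∃ l : List E, Metric.closedBall 0 (1 - ε) ⊆ zonotope l ∧
      zonotope l ⊆ Metric.closedBall 0 (1 + ε) := by
  obtain ⟨c, hc, hcv⟩ := exists_setIntegral_abs_inner_eq (E := E)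
  set μ := (volume : Measure E).restrict (Metric.closedBall 0 1) with hμ
  have hfin : IsFiniteMeasure μ :=
    ⟨by simpa [hμ] using (isCompact_closedBall (0 : E) 1).measure_lt_top⟩
  have hid : Integrable (fun u : E => u) μ :=
    continuous_id.continuousOn.integrableOn_compact (isCompact_closedBall _ _)
  -- The averaging integral is discretised by a simple function. Accuracy `ε * c` in L¹ becomes an
  -- error of at most `ε * ‖v‖` in the support function after division by `c`.
  obtain ⟨s, hs, hsmem⟩ := (memLp_one_iff_integrable.2 hid).exists_simpleFunc_eLpNorm_sub_lt
    ENNReal.one_ne_top (ε := ENNReal.ofReal (ε * c)) (by simpa using by positivity)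
  have hsint : Integrable s μ := memLp_one_iff_integrable.1 hsmem
  have hdiff : ∫ u, ‖u - s u‖ ∂μ < ε * c := by
    have hn := integral_norm_eq_lintegral_enorm (hid.sub hsint).aestronglyMeasurable
    simp only [Pi.sub_apply] at hn
    rw [hn]
    rw [eLpNorm_one_eq_lintegral_enorm] at hs
    exact (ENNReal.lt_ofReal_iff_toReal_lt (ne_top_of_lt hs)).1 hs
  -- Each value of the simple function spans a segment, weighted by the measure of its fibre, so
  -- that the zonotope's support function is the discretised integral divided by `c`.
  set l : List E := s.range.toList.map fun y => (μ.real (s ⁻¹' {y}) / c) • y with hl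
  have hsum : ∀ v : E, (l.map fun u => |inner ℝ u v|).sum = (∫ u, |inner ℝ (s u) v| ∂μ) / c := by
    intro v
    have h1 := SimpleFunc.map_integral s (fun y => |inner ℝ y v|) hsint (by simp)
    have h2 : Integrable (s.map fun y => |inner ℝ y v|) μ := by
      exact (hsint.inner_const v).abs
    rw [SimpleFunc.integral_eq_integral _ h2] at h1
    simp only [SimpleFunc.coe_map, Function.comp_def] at h1
    rw [h1, hl, List.map_map, Finset.sum_div, ← Finset.sum_map_toList]
    congr 1
    refine List.map_congr_left fun y _ => ?_
    have hw : 0 ≤ μ.real (s ⁻¹' {y}) / c := by positivity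
    simp only [Function.comp_apply, inner_smul_left, conj_trivial, abs_mul, abs_of_nonneg hw,
      smul_eq_mul]
    ring
  have hclose : ∀ v : E, |(∫ u, |inner ℝ (s u) v| ∂μ) - c * ‖v‖| ≤ ε * c * ‖v‖ := by
    intro v
    have i1 : Integrable (fun u => |inner ℝ (s u) v|) μ := (hsint.inner_const v).abs
    have i2 : Integrable (fun u => |inner ℝ u v|) μ := (hid.inner_const v).abs
    rw [← hcv v, ← integral_sub i1 i2]
    refine (abs_integral_le_integral_abs).trans ?_
    have : ∫ u, |(|inner ℝ (s u) v| - |inner ℝ u v|)| ∂μ ≤ ∫ u, ‖u - s u‖ * ‖v‖ ∂μ := by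
      refine integral_mono (i1.sub i2).abs ((hid.sub hsint).norm.mul_const _) fun u => ?_
      refine (abs_abs_sub_abs_le _ _).trans ?_
      rw [← inner_sub_left, norm_sub_rev u]
      exact abs_real_inner_le_norm _ _
    rw [integral_mul_const] at this
    exact this.trans (mul_le_mul_of_nonneg_right hdiff.le (norm_nonneg v))
  refine ⟨l, closedBall_subset_zonotope fun v => ?_, zonotope_subset_closedBall (by positivity) fun v => ?_⟩
  · rw [hsum, le_div_iff₀ hc]
    linarith [(abs_le.1 (hclose v)).1]
  · rw [hsum, div_le_iff₀ hc]
    linarith [(abs_le.1 (hclose v)).2]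

end Inner

/-! ### Steiner's formula for the ball -/

/-- The identification of `EuclideanSpace ℝ (Fin n)` with `Fin n → ℝ` as a linear map. -/
noncomputable def euclideanToPi (n : ℕ) : EuclideanSpace ℝ (Fin n) →ₗ[ℝ] (Fin n → ℝ) :=
  (PiLp.continuousLinearEquiv 2 ℝ (fun _ : Fin n => ℝ) :
    EuclideanSpace ℝ (Fin n) →ₗ[ℝ] (Fin n → ℝ))

theorem volume_real_euclideanToPi_image {n : ℕ} {S : Set (EuclideanSpace ℝ (Fin n))}
    (hS : IsCompact S) : volume.real (euclideanToPi n '' S) = volume.real S := by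
  have h1 : euclideanToPi n '' S = WithLp.toLp 2 ⁻¹' S :=
    (PiLp.continuousLinearEquiv 2 ℝ (fun _ : Fin n => ℝ)).toEquiv.image_eq_preimage_symm S
  rw [measureReal_def, measureReal_def, h1,
    (PiLp.volume_preserving_toLp (Fin n)).measure_preimage hS.measurableSet.nullMeasurableSet]

theorem exists_isNonnegExpansion_euclidean_zonotope {n : ℕ} (l : List (EuclideanSpace ℝ (Fin n)))
    {K : Set (EuclideanSpace ℝ (Fin n))} (hK : IsCompact K) (hc : Convex ℝ K) :
    ∃ a, IsNonnegExpansion n (fun ρ => volume.real (K + ρ • zonotope l)) a := by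
  obtain ⟨a, ha, haK⟩ := exists_isNonnegExpansion_zonotope (l.map (euclideanToPi n))
    (euclideanToPi n '' K) (hK.image (LinearMap.continuous_of_finiteDimensional _))
    (hc.linear_image _)
  refine ⟨a, ha, fun ρ hρ => ?_⟩
  rw [← haK ρ hρ]
  dsimp only
  rw [← volume_real_euclideanToPi_image (hK.add ((isCompact_zonotope l).smul ρ)), image_add,
    image_smul_set, image_zonotope]

theorem volume_real_smul {n : ℕ} {r : ℝ} (hr : 0 ≤ r) (S : Set (EuclideanSpace ℝ (Fin n))) :
    volume.real (r • S) = r ^ n * volume.real S := by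
  rw [measureReal_def, measureReal_def, Measure.addHaar_smul, ENNReal.toReal_mul,
    ENNReal.toReal_ofReal (abs_nonneg _), finrank_euclideanSpace_fin, abs_of_nonneg (by positivity)]

theorem isCompact_unitBall (n : ℕ) : IsCompact (unitBall n) := isCompact_closedBall _ _

theorem convex_unitBall (n : ℕ) : Convex ℝ (unitBall n) := convex_closedBall _ _

theorem smul_unitBall_eq_closedBall {n : ℕ} {r : ℝ} (hr : 0 ≤ r) :
    r • unitBall n = Metric.closedBall 0 r := by
  rw [unitBall, smul_closedBall _ _ zero_le_one]
  simp [abs_of_nonneg hr]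

/-- With `0 ∈ K` the body absorbs its own contractions, so `K + ρZ` lies between the dilates of `K +
ρB` by `1 - ε` and `1 + ε`. Volumes therefore converge and the limit lemma for expansions applies.
-/
theorem exists_isNonnegExpansion_ball_of_zero_mem {n : ℕ} (hn : 1 ≤ n)
    {K : Set (EuclideanSpace ℝ (Fin n))} (hK : IsCompact K) (hc : Convex ℝ K) (h0 : 0 ∈ K) :
    ∃ a, IsNonnegExpansion n (fun ρ => volume.real (K + ρ • unitBall n)) a := by
  have : Nontrivial (EuclideanSpace ℝ (Fin n)) := by
    have : Nonempty (Fin n) := ⟨⟨0, hn⟩⟩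
    infer_instance
  set ε : ℕ → ℝ := fun k => 1 / ((k : ℝ) + 1) with hε
  have hε0 : ∀ k, 0 < ε k := fun k => by positivity
  have hε1 : ∀ k, ε k ≤ 1 := fun k => by
    rw [hε]; dsimp only; rw [div_le_one (by positivity)]; linarith [k.cast_nonneg (α := ℝ)]
  have hlim : Tendsto ε atTop (𝓝 0) := tendsto_one_div_add_atTop_nhds_zero_nat
  choose l hl1 hl2 using fun k =>
    exists_zonotope_approx_closedBall (E := EuclideanSpace ℝ (Fin n)) (hε0 k)
  choose a ha using fun k => exists_isNonnegExpansion_euclidean_zonotope (l k) hK hc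
  obtain ⟨b, hb, -⟩ := IsNonnegExpansion.limit (l := atTop) ha
    (g₀ := fun ρ => volume.real (K + ρ • unitBall n)) fun ρ hρ => by
      set V := volume.real (K + ρ • unitBall n) with hV
      have hfinZ : ∀ k, volume (K + ρ • zonotope (l k)) ≠ ⊤ := fun k =>
        (hK.add ((isCompact_zonotope _).smul ρ)).measure_ne_top
      refine tendsto_of_tendsto_of_tendsto_of_le_of_le (g := fun k => (1 - ε k) ^ n * V)
        (h := fun k => (1 + ε k) ^ n * V) ?_ ?_ (fun k => ?_) (fun k => ?_)
      · simpa using ((hlim.const_sub 1).pow n).mul_const V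
      · simpa using ((hlim.const_add 1).pow n).mul_const V
      · dsimp only
        have h1 : 0 ≤ 1 - ε k := by linarith [hε1 k]
        rw [← volume_real_smul h1]
        refine measureReal_mono ?_ (hfinZ k)
        rw [smul_add, smul_comm (1 - ε k) ρ, smul_unitBall_eq_closedBall h1]
        refine add_subset_add ?_ (smul_set_mono (hl1 k))
        rintro _ ⟨x, hx, rfl⟩
        exact hc.smul_mem_of_zero_mem h0 hx ⟨h1, by linarith [hε0 k]⟩
      · dsimp only
        have h1 : 0 < 1 + ε k := by linarith [hε0 k]
        rw [← volume_real_smul h1.le]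
        refine measureReal_mono ?_
          ((hK.add ((isCompact_unitBall n).smul ρ)).smul (1 + ε k)).measure_ne_top
        rw [smul_add, smul_comm (1 + ε k) ρ, smul_unitBall_eq_closedBall h1.le]
        refine add_subset_add (fun x hx => ?_) (smul_set_mono (hl2 k))
        rw [mem_smul_set_iff_inv_smul_mem₀ h1.ne']
        exact hc.smul_mem_of_zero_mem h0 hx ⟨by positivity, inv_le_one_of_one_le₀ (by linarith [hε0 k])⟩
  exact ⟨b, hb⟩

/-- **Steiner's formula**: the volume of the parallel bodies of a compact convex set is a
polynomial with nonnegative coefficients. -/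
theorem exists_isNonnegExpansion_ball {n : ℕ} (hn : 1 ≤ n)
    {K : Set (EuclideanSpace ℝ (Fin n))} (hK : IsCompact K) (hc : Convex ℝ K) :
    ∃ a, IsNonnegExpansion n (fun ρ => volume.real (K + ρ • unitBall n)) a := by
  rcases K.eq_empty_or_nonempty with rfl | ⟨x, hx⟩
  · exact ⟨0, fun _ => le_rfl, fun ρ _ => by simp⟩
  · obtain ⟨a, ha, haK⟩ := exists_isNonnegExpansion_ball_of_zero_mem hn (hK.vadd (-x)) (hc.vadd (-x))
      ⟨x, hx, by simp⟩
    refine ⟨a, ha, fun ρ hρ => ?_⟩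
    rw [← haK ρ hρ]
    dsimp only
    rw [vadd_add_assoc, measureReal_def, measureReal_def, measure_vadd]

/-! ### Properties of quermassintegrals -/

section Quermassintegral

variable {n : ℕ} {K : Set (EuclideanSpace ℝ (Fin n))}

theorem isSteinerExpansion_quermassintegral (hn : 1 ≤ n) (hK : IsCompact K) (hc : Convex ℝ K) :
    IsSteinerExpansion n K (fun i => quermassintegral i K) := by
  have h : ∃ W, IsSteinerExpansion n K W := by
    obtain ⟨a, -, haK⟩ := exists_isNonnegExpansion_ball hn hK hc
    refine ⟨fun i => if i ≤ n then a i / n.choose i else 0, fun ρ hρ => ?_, fun i hi => ?_⟩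
    · refine (haK ρ hρ).trans ?_
      refine Finset.sum_congr rfl fun i hi => ?_
      have hi' : i ≤ n := Nat.lt_succ_iff.1 (Finset.mem_range.1 hi)
      have : (n.choose i : ℝ) ≠ 0 := by exact_mod_cast (Nat.choose_pos hi').ne'
      dsimp only
      rw [if_pos hi']
      field_simp
    · exact if_neg hi.not_ge
  convert h.choose_spec using 1
  funext i
  rw [quermassintegral, dif_pos h]

theorem volume_real_add_smul_unitBall (hn : 1 ≤ n) (hK : IsCompact K) (hc : Convex ℝ K) {ρ : ℝ}
    (hρ : 0 ≤ ρ) :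
    volume.real (K + ρ • unitBall n) =
      ∑ i ∈ Finset.range (n + 1), (n.choose i : ℝ) * quermassintegral i K * ρ ^ i :=
  (isSteinerExpansion_quermassintegral hn hK hc).1 ρ hρ

/-- The normalised quermassintegrals and the nonnegative coefficients from Steiner's formula give
the same values at `0, …, n`, so interpolation identifies them. -/
theorem quermassintegral_nonneg (hn : 1 ≤ n) (hK : IsCompact K) (hc : Convex ℝ K) (i : ℕ) :
    0 ≤ quermassintegral i K := by
  rcases lt_or_ge n i with hi | hi
  · exact ((isSteinerExpansion_quermassintegral hn hK hc).2 i hi).ge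
  obtain ⟨a, ha, haK⟩ := exists_isNonnegExpansion_ball hn hK hc
  obtain ⟨c, hcw⟩ := exists_interpolation_weights n
  have h1 : (n.choose i : ℝ) * quermassintegral i K = a i := by
    rw [hcw a i hi, hcw (fun i => (n.choose i : ℝ) * quermassintegral i K) i hi]
    refine Finset.sum_congr rfl fun k _ => ?_
    rw [← volume_real_add_smul_unitBall hn hK hc k.cast_nonneg, ← haK k k.cast_nonneg]
  have h2 : (0 : ℝ) < n.choose i := by exact_mod_cast Nat.choose_pos hi
  exact nonneg_of_mul_nonneg_right (h1 ▸ ha i) h2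

theorem isNonnegExpansion_quermassintegral (hn : 1 ≤ n) (hK : IsCompact K) (hc : Convex ℝ K) :
    IsNonnegExpansion n (fun ρ => volume.real (K + ρ • unitBall n))
      (fun i => (n.choose i : ℝ) * quermassintegral i K) :=
  ⟨fun i => mul_nonneg (Nat.cast_nonneg _) (quermassintegral_nonneg hn hK hc i),
    fun _ hρ => volume_real_add_smul_unitBall hn hK hc hρ⟩

theorem unitBall_add_smul_eq {ρ : ℝ} (hρ : 0 < ρ) (S : Set (EuclideanSpace ℝ (Fin n))) :
    unitBall n + ρ • S = ρ • (S + ρ⁻¹ • unitBall n) := by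
  rw [smul_add, smul_smul, mul_inv_cancel₀ hρ.ne', one_smul, add_comm]

/-- Pulling out the factor `ρ` from `B + ρK` turns Steiner's formula at `ρ⁻¹` into the polynomial
with reversed coefficients. -/
theorem volume_real_unitBall_add_smul (hn : 1 ≤ n) (hK : IsCompact K) (hc : Convex ℝ K) {ρ : ℝ}
    (hρ : 0 < ρ) :
    volume.real (unitBall n + ρ • K) =
      ∑ j ∈ Finset.range (n + 1), (n.choose j : ℝ) * quermassintegral (n - j) K * ρ ^ j := by
  rw [unitBall_add_smul_eq hρ, volume_real_smul hρ.le,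
    volume_real_add_smul_unitBall hn hK hc (inv_nonneg.2 hρ.le), Finset.mul_sum,
    ← Finset.sum_range_reflect]
  refine Finset.sum_congr rfl fun j hj => ?_
  have hj' : j ≤ n := Nat.lt_succ_iff.1 (Finset.mem_range.1 hj)
  rw [Nat.add_sub_cancel, Nat.choose_symm hj', inv_pow]
  have : ρ ^ n = ρ ^ j * ρ ^ (n - j) := by rw [← pow_add, Nat.add_sub_cancel' hj']
  rw [this]
  field_simp

theorem isCompact_unitBall_add_smul (hK : IsCompact K) (ρ : ℝ) :
    IsCompact (unitBall n + ρ • K) := (isCompact_unitBall n).add (hK.smul ρ)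

theorem ballVolume_le_volume_unitBall_add {S : Set (EuclideanSpace ℝ (Fin n))} (hS : S.Nonempty) :
    volume (unitBall n) ≤ volume (unitBall n + S) := by
  obtain ⟨x, hx⟩ := hS
  rw [← measure_preimage_add_right volume x (unitBall n + S)]
  exact measure_mono fun y hy => add_mem_add hy hx

theorem ballVolume_pos (n : ℕ) : 0 < ballVolume n :=
  ENNReal.toReal_pos (Metric.measure_closedBall_pos _ _ one_pos).ne'
    (isCompact_unitBall n).measure_ne_top

theorem ofReal_ballVolume (n : ℕ) : ENNReal.ofReal (ballVolume n) = volume (unitBall n) :=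
  ENNReal.ofReal_toReal (isCompact_unitBall n).measure_ne_top

/-- The reversed polynomial has constant term `W_n`, and as `ρ → 0⁺` the volume of `B + ρK` is
squeezed between those of `B` and of `(1 + ρR)B`. -/
theorem quermassintegral_dim (hn : 1 ≤ n) (hK : IsCompact K) (hc : Convex ℝ K)
    (hne : K.Nonempty) : quermassintegral n K = ballVolume n := by
  set p : ℝ → ℝ := fun ρ =>
    ∑ j ∈ Finset.range (n + 1), (n.choose j : ℝ) * quermassintegral (n - j) K * ρ ^ j with hp
  have hp0 : p 0 = quermassintegral n K := by
    rw [hp]; dsimp only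
    rw [Finset.sum_eq_single 0]
    · simp
    · intro j _ hj; simp [hj]
    · simp
  have hpc : Continuous p := by fun_prop
  have h1 : Tendsto p (𝓝[>] 0) (𝓝 (quermassintegral n K)) :=
    hp0 ▸ (hpc.tendsto 0).mono_left nhdsWithin_le_nhds
  obtain ⟨R, hR0, hR⟩ := hK.isBounded.subset_closedBall_lt 0 0
  refine tendsto_nhds_unique h1 ?_
  have hup : Tendsto (fun ρ : ℝ => (1 + ρ * R) ^ n * ballVolume n) (𝓝[>] 0) (𝓝 (ballVolume n)) := by
    have : Continuous fun ρ : ℝ => (1 + ρ * R) ^ n * ballVolume n := by fun_prop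
    exact (this.tendsto' 0 _ (by simp)).mono_left nhdsWithin_le_nhds
  refine tendsto_of_tendsto_of_tendsto_of_le_of_le' tendsto_const_nhds hup ?_ ?_
  · filter_upwards [self_mem_nhdsWithin] with ρ hρ
    rw [hp]; dsimp only
    rw [← volume_real_unitBall_add_smul hn hK hc hρ]
    exact ENNReal.toReal_mono (isCompact_unitBall_add_smul hK ρ).measure_ne_top
      (ballVolume_le_volume_unitBall_add hne.smul_set)
  · filter_upwards [self_mem_nhdsWithin] with ρ hρ
    have hρ' : (0 : ℝ) < ρ := hρ
    rw [hp]; dsimp only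
    rw [← volume_real_unitBall_add_smul hn hK hc hρ, ballVolume,
      ← volume_real_smul (by positivity)]
    refine measureReal_mono ?_ ((isCompact_unitBall n).smul _).measure_ne_top
    rw [smul_unitBall_eq_closedBall (by positivity)]
    rintro _ ⟨x, hx, _, ⟨y, hy, rfl⟩, rfl⟩
    rw [mem_closedBall_zero_iff]
    refine (norm_add_le _ _).trans (add_le_add (mem_closedBall_zero_iff.1 hx) ?_)
    rw [norm_smul, Real.norm_of_nonneg hρ'.le]
    exact mul_le_mul_of_nonneg_left (mem_closedBall_zero_iff.1 (hR hy)) hρ'.le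

/-- Interpolation writes each quermassintegral as a combination of finitely many parallel volumes,
which are antitone in `t`. -/
theorem aemeasurable_quermassintegral (hn : 1 ≤ n) {K : ℝ → Set (EuclideanSpace ℝ (Fin n))}
    (hK : ∀ t, 0 < t → IsCompact (K t)) (hc : ∀ t, 0 < t → Convex ℝ (K t)) (hanti : Antitone K)
    {i : ℕ} (hi : i ≤ n) :
    AEMeasurable (fun t => quermassintegral i (K t)) (volume.restrict (Ioi 0)) := by
  obtain ⟨c, hcw⟩ := exists_interpolation_weights n
  have hmeas : ∀ k : ℕ, AEMeasurable (fun t => volume.real (K t + (k : ℝ) • unitBall n))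
      (volume.restrict (Ioi 0)) := fun k => by
    refine aemeasurable_restrict_of_antitoneOn measurableSet_Ioi fun s hs t ht hst => ?_
    exact measureReal_mono (add_subset_add_right (hanti hst))
      ((hK s hs).add ((isCompact_unitBall n).smul _)).measure_ne_top
  have : AEMeasurable (fun t => (∑ k ∈ Finset.range (n + 1),
      c i k * volume.real (K t + (k : ℝ) • unitBall n)) / n.choose i)
      (volume.restrict (Ioi 0)) :=
    (Finset.aemeasurable_fun_sum _ fun k _ => (hmeas k).const_mul _).div_const _
  refine this.congr ?_
  filter_upwards [self_mem_ae_restrict measurableSet_Ioi] with t ht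
  have h2 : (n.choose i : ℝ) ≠ 0 := by exact_mod_cast (Nat.choose_pos hi).ne'
  rw [div_eq_iff h2, mul_comm,
    hcw (fun i => (n.choose i : ℝ) * quermassintegral i (K t)) i hi]
  refine Finset.sum_congr rfl fun k _ => ?_
  rw [volume_real_add_smul_unitBall hn (hK t ht) (hc t ht) k.cast_nonneg]

/-- The terms of degree at least two in the reversed polynomial are nonnegative and are dropped. -/
theorem ballVolume_add_le_volume (hn : 1 ≤ n) (hK : IsCompact K) (hc : Convex ℝ K)
    (hne : K.Nonempty) {ρ : ℝ} (hρ : 0 < ρ) :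
    ballVolume n + ρ * (n * quermassintegral (n - 1) K) ≤ volume.real (unitBall n + ρ • K) := by
  obtain ⟨m, rfl⟩ : ∃ m, n = m + 1 := ⟨n - 1, by omega⟩
  rw [volume_real_unitBall_add_smul hn hK hc hρ, Finset.sum_range_succ', Finset.sum_range_succ',
    ← quermassintegral_dim hn hK hc hne]
  have : 0 ≤ ∑ k ∈ Finset.range m, ((m + 1).choose (k + 1 + 1) : ℝ) *
      quermassintegral (m + 1 - (k + 1 + 1)) K * ρ ^ (k + 1 + 1) :=
    Finset.sum_nonneg fun k _ => by
      have := quermassintegral_nonneg hn hK hc (m + 1 - (k + 1 + 1))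
      positivity
  simp at this ⊢
  linarith

/-- Quermassintegrals converge along a sequence of convex bodies whose parallel volumes
converge. -/
theorem tendsto_quermassintegral (hn : 1 ≤ n) {ι : Type*} {l : Filter ι} [l.NeBot]
    {S : ι → Set (EuclideanSpace ℝ (Fin n))} (hS : ∀ k, IsCompact (S k))
    (hSc : ∀ k, Convex ℝ (S k)) (hK : IsCompact K) (hc : Convex ℝ K)
    (h : ∀ ρ : ℝ, 0 ≤ ρ → Tendsto (fun k => volume.real (S k + ρ • unitBall n)) l
      (𝓝 (volume.real (K + ρ • unitBall n)))) {i : ℕ} (hi : i ≤ n) :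
    Tendsto (fun k => quermassintegral i (S k)) l (𝓝 (quermassintegral i K)) := by
  obtain ⟨b, hb, hlim⟩ := IsNonnegExpansion.limit
    (fun k => isNonnegExpansion_quermassintegral hn (hS k) (hSc k)) h
  obtain ⟨c, hcw⟩ := exists_interpolation_weights n
  have hbi : b i = n.choose i * quermassintegral i K := by
    rw [hcw b i hi, hcw (fun i => (n.choose i : ℝ) * quermassintegral i K) i hi]
    refine Finset.sum_congr rfl fun k _ => ?_
    rw [← hb.2 k k.cast_nonneg, ← volume_real_add_smul_unitBall hn hK hc k.cast_nonneg]
  have h2 : (n.choose i : ℝ) ≠ 0 := by exact_mod_cast (Nat.choose_pos hi).ne'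
  have := (hlim i hi).const_mul (n.choose i : ℝ)⁻¹
  rw [hbi] at this
  simpa [h2] using this

end Quermassintegral

/-! ### Layer-cake representation and the dual Steiner formula -/

section DualSteiner

variable {n : ℕ} {f : EuclideanSpace ℝ (Fin n) → ℝ≥0∞}

/-- The sum with the closure lies in the closure of the sum, and a convex set has a null frontier.
-/
theorem volume_add_closure {A C : Set (EuclideanSpace ℝ (Fin n))} (hC : Convex ℝ C)
    (hA : Convex ℝ A) : volume (C + closure A) = volume (C + A) := by
  refine le_antisymm ?_ (measure_mono (add_subset_add_left subset_closure))
  rw [← measure_closure_of_null_frontier ((hC.add hA).addHaar_frontier volume)]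
  refine measure_mono ?_
  rintro _ ⟨x, hx, y, hy, rfl⟩
  exact map_mem_closure (f := fun y => x + y) (by fun_prop) hy fun z hz => add_mem_add hx hz

theorem volume_unitBall_add_smul_closure {A : Set (EuclideanSpace ℝ (Fin n))} (hA : Convex ℝ A)
    (ρ : ℝ) : volume (unitBall n + ρ • closure A) = volume (unitBall n + ρ • A) := by
  rw [← closure_smul₀, volume_add_closure (convex_unitBall n) (hA.smul ρ)]

theorem IsClassQ.isCompact_superlevel (hf : IsClassQ f) {c : ℝ≥0∞} (hc : 0 < c) :
    IsCompact {x | c ≤ f x} := by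
  have hcl : IsClosed {x | c ≤ f x} := hf.upperSemicontinuous.isClosed_preimage c
  have h := hf.vanishing.eventually_lt_const hc
  obtain ⟨S, hS, hSc⟩ := mem_cocompact.1 h
  refine hS.of_isClosed_subset hcl fun x hx => ?_
  by_contra hxS
  have h' : f x < c := hSc hxS
  exact h'.not_ge hx

theorem IsClassQ.convex_superlevel (hf : IsClassQ f) (c : ℝ≥0∞) : Convex ℝ {x | c < f x} := by
  simpa using hf.quasiconcave.convex_gt c

theorem IsClassQ.exists_isMax (hf : IsClassQ f) : ∃ x₀, ∀ x, f x ≤ f x₀ := by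
  obtain ⟨x, hx⟩ := hf.ne_zero
  have hx' : 0 < f x := pos_iff_ne_zero.2 hx
  obtain ⟨x₀, hx₀, hmax⟩ := (hf.upperSemicontinuous.upperSemicontinuousOn _).exists_isMaxOn
    ⟨x, le_refl (f x)⟩ (hf.isCompact_superlevel hx')
  refine ⟨x₀, fun y => ?_⟩
  rcases le_total (f x) (f y) with h | h
  · exact hmax h
  · exact h.trans hx₀

theorem IsClassQ.isCompact_closedSuperlevel (hf : IsClassQ f) {t : ℝ} (ht : 0 < t) :
    IsCompact (closedSuperlevel f t) := by
  have h := hf.isCompact_superlevel (ENNReal.ofReal_pos.2 ht)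
  exact h.of_isClosed_subset isClosed_closure
    (closure_minimal (fun x (hx : _ < f x) => hx.le) h.isClosed)

theorem IsClassQ.convex_closedSuperlevel (hf : IsClassQ f) (t : ℝ) :
    Convex ℝ (closedSuperlevel f t) := (hf.convex_superlevel _).closure

theorem antitone_closedSuperlevel : Antitone (closedSuperlevel f) := fun _ _ hst =>
  closure_mono fun _ hx => (ENNReal.ofReal_le_ofReal hst).trans_lt hx

/-- Strict inequality passes through a supremum without its being attained, which makes this an
equality of sets. -/
theorem setOf_rpow_lt_logSum {ρ : ℝ} (hρ : 0 < ρ) (d : ℝ≥0∞) :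
    {z | d ^ ρ < logSum 1 ρ (ballIndicator n) f z} = unitBall n + ρ • {y | d < f y} := by
  ext z
  simp only [logSum, mem_ofPred_eq, lt_iSup_iff, one_smul, ENNReal.rpow_one, ballIndicator]
  constructor
  · rintro ⟨x, y, rfl, h⟩
    by_cases hx : x ∈ unitBall n
    · rw [indicator_of_mem hx, Pi.one_apply, one_mul, ENNReal.rpow_lt_rpow_iff hρ] at h
      exact add_mem_add hx (smul_mem_smul_set h)
    · simp [indicator_of_notMem hx] at h
  · rintro ⟨x, hx, _, ⟨y, hy, rfl⟩, rfl⟩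
    refine ⟨x, y, rfl, ?_⟩
    rw [indicator_of_mem hx, Pi.one_apply, one_mul, ENNReal.rpow_lt_rpow_iff hρ]
    exact hy

/-- Superlevel sets of the sup-convolution are sums of convex sets, hence convex and null
measurable. -/
theorem IsClassQ.aemeasurable_logSum (hf : IsClassQ f) {ρ : ℝ} (hρ : 0 < ρ) :
    AEMeasurable (logSum 1 ρ (ballIndicator n) f) := by
  refine NullMeasurable.aemeasurable ?_
  refine measurable_of_Ioi fun c => ?_
  have h := setOf_rpow_lt_logSum (f := f) hρ (c ^ ρ⁻¹)
  rw [ENNReal.rpow_inv_rpow hρ.ne'] at h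
  have hm := ((convex_unitBall n).add ((hf.convex_superlevel (c ^ ρ⁻¹)).smul ρ)).nullMeasurableSet
    volume
  rw [← h] at hm
  exact hm

/-- The layer-cake formula with exponent `ρ` is applied to `L ^ ρ⁻¹`, whose superlevel set at height
`t` is `B + ρ{f > t}`. Finiteness of `M` allows the passage to real values. -/
theorem IsClassQ.dualPsi_eq_lintegral (hf : IsClassQ f) {M : ℝ≥0∞} (hM : M ≠ ⊤)
    (hfM : ∀ x, f x ≤ M) {ρ : ℝ} (hρ : 0 < ρ) :
    dualPsi f ρ = ENNReal.ofReal ρ * ∫⁻ t in Ioi (0 : ℝ),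
      volume (unitBall n + ρ • {x | ENNReal.ofReal t < f x}) * ENNReal.ofReal (t ^ (ρ - 1)) := by
  set L := logSum 1 ρ (ballIndicator n) f with hL
  have hLM : ∀ z, L z ≤ M ^ ρ := fun z => by
    by_contra! h
    have hz : z ∈ {z | M ^ ρ < L z} := h
    rw [hL, setOf_rpow_lt_logSum hρ] at hz
    obtain ⟨x, -, _, ⟨y, hy, rfl⟩, -⟩ := hz
    exact absurd hy (not_lt.2 (hfM y))
  have hLtop : ∀ z, L z ^ ρ⁻¹ ≠ ⊤ := fun z =>
    ENNReal.rpow_ne_top_of_nonneg (inv_nonneg.2 hρ.le)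
      (ne_top_of_le_ne_top (ENNReal.rpow_ne_top_of_nonneg hρ.le hM) (hLM z))
  have hmeas : AEMeasurable (fun z => (L z ^ ρ⁻¹).toReal) :=
    ((hf.aemeasurable_logSum hρ).pow_const _).ennreal_toReal
  have h := lintegral_rpow_eq_lintegral_meas_lt_mul (volume : Measure (EuclideanSpace ℝ (Fin n)))
    (ae_of_all _ fun z => (ENNReal.toReal_nonneg : 0 ≤ (L z ^ ρ⁻¹).toReal)) hmeas hρ
  have h1 : dualPsi f ρ = ∫⁻ z, ENNReal.ofReal ((L z ^ ρ⁻¹).toReal ^ ρ) := by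
    refine lintegral_congr fun z => ?_
    rw [ENNReal.toReal_rpow, ENNReal.rpow_inv_rpow hρ.ne', ENNReal.ofReal_toReal]
    exact ne_top_of_le_ne_top (ENNReal.rpow_ne_top_of_nonneg hρ.le hM) (hLM z)
  rw [h1, h]
  congr 1
  refine setLIntegral_congr_fun measurableSet_Ioi fun t ht => ?_
  rw [← setOf_rpow_lt_logSum hρ]
  congr 2
  ext z
  rw [mem_ofPred_eq, mem_ofPred_eq, ← ENNReal.ofReal_lt_iff_lt_toReal (le_of_lt ht) (hLtop z),
    ← ENNReal.rpow_lt_rpow_iff hρ, ENNReal.rpow_inv_rpow hρ.ne']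

theorem dualPsi_eq_top {x₀ : EuclideanSpace ℝ (Fin n)} (hx₀ : f x₀ = ⊤) {ρ : ℝ} (hρ : 0 < ρ) :
    dualPsi f ρ = ⊤ := by
  rw [eq_top_iff]
  have hsub : ∀ x ∈ unitBall n, logSum 1 ρ (ballIndicator n) f (x + ρ • x₀) = ⊤ := fun x hx => by
    rw [eq_top_iff, logSum]
    refine le_iSup_of_le x (le_iSup_of_le x₀ (le_iSup_of_le (by simp) ?_))
    rw [ballIndicator, indicator_of_mem hx, hx₀, ENNReal.top_rpow_of_pos hρ]
    simp
  rw [dualPsi, ← lintegral_add_right_eq_self _ (ρ • x₀)]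
  calc (⊤ : ℝ≥0∞) = ∫⁻ _ in unitBall n, ⊤ := by
        rw [setLIntegral_const, unitBall, ENNReal.top_mul (Metric.measure_closedBall_pos _ _ one_pos).ne']
    _ = ∫⁻ x in unitBall n, logSum 1 ρ (ballIndicator n) f (x + ρ • x₀) :=
        setLIntegral_congr_fun (isCompact_unitBall n).measurableSet fun x hx => (hsub x hx).symm
    _ ≤ _ := setLIntegral_le_lintegral _ _

theorem lintegral_Ioi_rpow_eq_top (s : ℝ) : ∫⁻ t in Ioi (0 : ℝ), ENNReal.ofReal (t ^ s) = ⊤ := by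
  by_contra h
  refine not_integrableOn_Ioi_rpow s ?_
  refine (lintegral_ofReal_ne_top_iff_integrable ?_ ?_).1 h
  · exact (by fun_prop : Measurable fun t : ℝ => t ^ s).aestronglyMeasurable
  · filter_upwards [self_mem_ae_restrict measurableSet_Ioi] with t ht
    exact Real.rpow_nonneg (le_of_lt ht) s

theorem lintegral_Ioc_rpow_sub_one {ρ : ℝ} (hρ : 0 < ρ) {a b : ℝ} (ha : 0 ≤ a)
    (hab : a ≤ b) :
    ENNReal.ofReal ρ * ∫⁻ t in Ioc a b, ENNReal.ofReal (t ^ (ρ - 1)) =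
      ENNReal.ofReal (b ^ ρ - a ^ ρ) := by
  have hint : IntervalIntegrable (fun t : ℝ => t ^ (ρ - 1)) volume a b :=
    intervalIntegral.intervalIntegrable_rpow' (by linarith)
  rw [← ofReal_integral_eq_lintegral_ofReal ((intervalIntegrable_iff_integrableOn_Ioc_of_le hab).1
    hint), ← intervalIntegral.integral_of_le hab, integral_rpow (Or.inl (by linarith)),
    ← ENNReal.ofReal_mul hρ.le, sub_add_cancel]
  · congr 1
    field_simp
  · filter_upwards [self_mem_ae_restrict measurableSet_Ioc] with t ht
    exact Real.rpow_nonneg (ha.trans ht.1.le) _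

/-- The dual Steiner-type formula. -/
theorem IsClassQ.dualPsi_eq_sum (hn : 1 ≤ n) (hf : IsClassQ f) {ρ : ℝ} (hρ : 0 < ρ) :
    dualPsi f ρ = ∑ j ∈ Finset.range (n + 1),
        (n.choose j : ℝ≥0∞) * ENNReal.ofReal (ρ ^ (j + 1)) *
          ∫⁻ t in Ioi (0 : ℝ),
            ENNReal.ofReal (quermassintegral (n - j) (closedSuperlevel f t) * t ^ (ρ - 1)) := by
  obtain ⟨x₀, hx₀⟩ := hf.exists_isMax
  by_cases htop : f x₀ = ⊤
  · rw [dualPsi_eq_top htop hρ, eq_comm, ENNReal.sum_eq_top]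
    -- The term `j = 0` already diverges: every superlevel set contains `x₀`, so `W_n` is constantly
    -- the volume of the ball, and `t ^ (ρ - 1)` is not integrable on the half-line.
    refine ⟨0, by simp, ?_⟩
    have : ∫⁻ t in Ioi (0 : ℝ),
        ENNReal.ofReal (quermassintegral (n - 0) (closedSuperlevel f t) * t ^ (ρ - 1)) = ⊤ := by
      rw [setLIntegral_congr_fun (g := fun t =>
        ENNReal.ofReal (ballVolume n) * ENNReal.ofReal (t ^ (ρ - 1))) measurableSet_Ioi,
        lintegral_const_mul _ (by fun_prop), lintegral_Ioi_rpow_eq_top, ENNReal.mul_top]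
      · exact (ENNReal.ofReal_pos.2 (ballVolume_pos n)).ne'
      · intro t ht
        dsimp only
        rw [Nat.sub_zero, quermassintegral_dim hn (hf.isCompact_closedSuperlevel ht)
          (hf.convex_closedSuperlevel t) ⟨x₀, subset_closure (by simp [htop])⟩,
          ENNReal.ofReal_mul (ballVolume_pos n).le]
    rw [this, ENNReal.mul_top]
    simpa using hρ
  · rw [hf.dualPsi_eq_lintegral htop hx₀ hρ]
    have hint : ∀ t ∈ Ioi (0 : ℝ), volume (unitBall n + ρ • {x | ENNReal.ofReal t < f x}) *
        ENNReal.ofReal (t ^ (ρ - 1)) = ∑ j ∈ Finset.range (n + 1),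
        ((n.choose j : ℝ≥0∞) * ENNReal.ofReal (ρ ^ j)) *
          ENNReal.ofReal (quermassintegral (n - j) (closedSuperlevel f t) * t ^ (ρ - 1)) := by
      intro t ht
      have hK := hf.isCompact_closedSuperlevel ht
      have hc := hf.convex_closedSuperlevel t
      have hW := quermassintegral_nonneg hn hK hc
      rw [← volume_unitBall_add_smul_closure (hf.convex_superlevel _),
        ← ENNReal.ofReal_toReal (a := volume (unitBall n + ρ • closure _))
          (isCompact_unitBall_add_smul hK ρ).measure_ne_top]
      change ENNReal.ofReal (volume.real (unitBall n + ρ • closedSuperlevel f t)) * _ = _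
      rw [volume_real_unitBall_add_smul hn hK hc hρ, ENNReal.ofReal_sum_of_nonneg fun j _ => by
        have := hW (n - j); positivity, Finset.sum_mul]
      refine Finset.sum_congr rfl fun j _ => ?_
      rw [ENNReal.ofReal_mul (mul_nonneg (Nat.cast_nonneg _) (hW _)),
        ENNReal.ofReal_mul (Nat.cast_nonneg _), ENNReal.ofReal_mul (hW _), ENNReal.ofReal_natCast]
      ring
    rw [setLIntegral_congr_fun measurableSet_Ioi hint, lintegral_finsetSum', Finset.mul_sum]
    · refine Finset.sum_congr rfl fun j _ => ?_
      rw [lintegral_const_mul' _ _ (ENNReal.mul_ne_top (ENNReal.natCast_ne_top _)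
        ENNReal.ofReal_ne_top), pow_succ, ENNReal.ofReal_mul (by positivity)]
      ring
    · intro j _
      refine AEMeasurable.const_mul (AEMeasurable.ennreal_ofReal ?_) _
      exact (aemeasurable_quermassintegral hn (fun t ht => hf.isCompact_closedSuperlevel ht)
        (fun t _ => hf.convex_closedSuperlevel t) antitone_closedSuperlevel (Nat.sub_le n j)).mul
        (by fun_prop)

/-! ### Bounds for Ψ and its right derivative at zero -/

theorem dualPsi_zero : dualPsi f 0 = volume (unitBall n) := by
  rw [dualPsi, ← lintegral_indicator_one (isCompact_unitBall n).measurableSet]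
  refine lintegral_congr fun z => ?_
  simp only [logSum, one_smul, zero_smul, add_zero, ENNReal.rpow_zero, mul_one, ENNReal.rpow_one,
    ballIndicator]
  refine le_antisymm (iSup_le fun x => iSup_le fun _ => iSup_le fun h => h ▸ le_rfl) ?_
  exact le_iSup_of_le z (le_iSup_of_le 0 (le_iSup_of_le rfl le_rfl))

theorem coe_dualPsi_zero : (dualPsi f 0 : EReal) = (ballVolume n : EReal) := by
  rw [dualPsi_zero, ← ofReal_ballVolume, EReal.coe_ennreal_ofReal, max_eq_left (ballVolume_pos n).le]

/-- For `t ≤ s` the layer has volume at least `κ + ρA` by monotonicity, and for `s < t < m` it still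
contains a translate of the ball. Integrating `ρ t^(ρ-1)` over the two ranges gives the bound. -/
theorem IsClassQ.ofReal_le_dualPsi (hf : IsClassQ f) {x₀ : EuclideanSpace ℝ (Fin n)} {m s A ρ : ℝ}
    (hm : f x₀ = ENNReal.ofReal m) (hmax : ∀ x, f x ≤ f x₀) (hs : 0 < s) (hsm : s ≤ m)
    (hA : 0 ≤ A) (hρ : 0 < ρ)
    (hV : ENNReal.ofReal (ballVolume n + ρ * A) ≤
      volume (unitBall n + ρ • {x | ENNReal.ofReal s < f x})) :
    ENNReal.ofReal (ballVolume n * m ^ ρ + ρ * A * s ^ ρ) ≤ dualPsi f ρ := by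
  have hκ := ballVolume_pos n
  have hpow : s ^ ρ ≤ m ^ ρ := Real.rpow_le_rpow hs.le hsm hρ.le
  have hsp : 0 ≤ s ^ ρ := Real.rpow_nonneg hs.le ρ
  rw [hf.dualPsi_eq_lintegral (hm ▸ ENNReal.ofReal_ne_top : f x₀ ≠ ⊤) hmax hρ]
  set g : ℝ → ℝ≥0∞ := fun t =>
    volume (unitBall n + ρ • {x | ENNReal.ofReal t < f x}) * ENNReal.ofReal (t ^ (ρ - 1)) with hg
  -- The height `m` is excluded because the strict superlevel set is empty there; a single point
  -- does not affect the integral.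
  have hsub : Ioc 0 s ∪ Ioo s m ⊆ Ioi 0 :=
    union_subset (fun t ht => ht.1) fun t ht => hs.trans ht.1
  have hdisj : Disjoint (Ioc 0 s) (Ioo s m) :=
    disjoint_left.2 fun t h1 h2 => not_lt.2 h1.2 h2.1
  have h1 : ENNReal.ofReal (ballVolume n + ρ * A) * ∫⁻ t in Ioc 0 s, ENNReal.ofReal (t ^ (ρ - 1)) ≤
      ∫⁻ t in Ioc 0 s, g t := by
    rw [← lintegral_const_mul _ (by fun_prop)]
    refine setLIntegral_mono' measurableSet_Ioc fun t ht => mul_le_mul_left (hV.trans ?_) _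
    exact measure_mono (add_subset_add_left (smul_set_mono fun x hx =>
      (ENNReal.ofReal_le_ofReal ht.2).trans_lt hx))
  have h2 : ENNReal.ofReal (ballVolume n) * ∫⁻ t in Ioc s m, ENNReal.ofReal (t ^ (ρ - 1)) ≤
      ∫⁻ t in Ioo s m, g t := by
    rw [← setLIntegral_congr Ioo_ae_eq_Ioc, ← lintegral_const_mul _ (by fun_prop),
      ofReal_ballVolume]
    refine setLIntegral_mono' measurableSet_Ioo fun t ht => mul_le_mul_left ?_ _
    refine ballVolume_le_volume_unitBall_add (Nonempty.smul_set ⟨x₀, ?_⟩)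
    rw [mem_ofPred_eq, hm]
    exact (ENNReal.ofReal_lt_ofReal_iff (by linarith)).2 ht.2
  calc ENNReal.ofReal (ballVolume n * m ^ ρ + ρ * A * s ^ ρ)
      = ENNReal.ofReal (ballVolume n + ρ * A) * ENNReal.ofReal (s ^ ρ - 0 ^ ρ) +
        ENNReal.ofReal (ballVolume n) * ENNReal.ofReal (m ^ ρ - s ^ ρ) := by
        rw [Real.zero_rpow hρ.ne', sub_zero, ← ENNReal.ofReal_mul (by positivity),
          ← ENNReal.ofReal_mul hκ.le, ← ENNReal.ofReal_add (by positivity)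
            (mul_nonneg hκ.le (by linarith))]
        congr 1; ring
    _ = ENNReal.ofReal ρ * (ENNReal.ofReal (ballVolume n + ρ * A) *
          (∫⁻ t in Ioc 0 s, ENNReal.ofReal (t ^ (ρ - 1))) +
        ENNReal.ofReal (ballVolume n) * ∫⁻ t in Ioc s m, ENNReal.ofReal (t ^ (ρ - 1))) := by
        rw [← lintegral_Ioc_rpow_sub_one hρ le_rfl hs.le, ← lintegral_Ioc_rpow_sub_one hρ hs.le hsm]
        ring
    _ ≤ ENNReal.ofReal ρ * ∫⁻ t in Ioc 0 s ∪ Ioo s m, g t := by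
        rw [lintegral_union measurableSet_Ioo hdisj]
        gcongr
    _ ≤ _ := by
        gcongr

theorem IsClassQ.dualPsi_le (hf : IsClassQ f) {x₀ : EuclideanSpace ℝ (Fin n)} {m ρ : ℝ}
    (hm0 : 0 < m) (hm : f x₀ = ENNReal.ofReal m) (hmax : ∀ x, f x ≤ f x₀) (hρ : 0 < ρ)
    (hK : IsCompact (fnSupport f)) :
    dualPsi f ρ ≤ ENNReal.ofReal (m ^ ρ * volume.real (unitBall n + ρ • fnSupport f)) := by
  have hV := (isCompact_unitBall_add_smul hK ρ).measure_ne_top (μ := volume)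
  rw [hf.dualPsi_eq_lintegral (hm ▸ ENNReal.ofReal_ne_top : f x₀ ≠ ⊤) hmax hρ,
    ← Ioc_union_Ioi_eq_Ioi hm0.le]
  set V := volume (unitBall n + ρ • fnSupport f) with hVdef
  have h1 : ∫⁻ t in Ioc 0 m, volume (unitBall n + ρ • {x | ENNReal.ofReal t < f x}) *
      ENNReal.ofReal (t ^ (ρ - 1)) ≤ V * ∫⁻ t in Ioc 0 m, ENNReal.ofReal (t ^ (ρ - 1)) := by
    rw [← lintegral_const_mul _ (by fun_prop)]
    refine setLIntegral_mono' measurableSet_Ioc fun t ht => mul_le_mul_left ?_ _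
    exact measure_mono (add_subset_add_left (smul_set_mono fun x hx =>
      subset_closure (pos_of_gt hx : 0 < f x)))
  have h2 : ∫⁻ t in Ioi m, volume (unitBall n + ρ • {x | ENNReal.ofReal t < f x}) *
      ENNReal.ofReal (t ^ (ρ - 1)) = 0 := by
    rw [setLIntegral_congr_fun (g := fun _ => 0) measurableSet_Ioi, lintegral_zero]
    intro t ht
    have : {x | ENNReal.ofReal t < f x} = ∅ := eq_empty_of_forall_notMem fun x hx =>
      not_lt.2 (((hmax x).trans hm.le).trans (ENNReal.ofReal_le_ofReal (le_of_lt ht))) hx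
    simp [this]
  calc _ ≤ ENNReal.ofReal ρ * (V * (∫⁻ t in Ioc 0 m, ENNReal.ofReal (t ^ (ρ - 1))) + 0) := by
        gcongr
        exact (lintegral_union_le _ _ _).trans (add_le_add h1 h2.le)
    _ = _ := by
        rw [add_zero, mul_left_comm, lintegral_Ioc_rpow_sub_one hρ le_rfl hm0.le,
          Real.zero_rpow hρ.ne', sub_zero, measureReal_def, ENNReal.ofReal_mul (by positivity),
          ENNReal.ofReal_toReal hV, mul_comm]

theorem tendsto_rpow_sub_one_div {m : ℝ} (hm : 0 < m) :
    Tendsto (fun ρ : ℝ => (m ^ ρ - 1) / ρ) (𝓝[>] 0) (𝓝 (Real.log m)) := by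
  have h := (hasDerivAt_iff_tendsto_slope_zero.1
    (Real.hasStrictDerivAt_const_rpow hm 0).hasDerivAt).mono_left
    (nhdsWithin_mono 0 fun x (hx : 0 < x) => hx.ne')
  simp only [zero_add, Real.rpow_zero, one_mul, smul_eq_mul] at h
  exact h.congr fun ρ => by rw [div_eq_inv_mul]

theorem tendsto_rpow_nhdsGT_zero {m : ℝ} (hm : 0 < m) :
    Tendsto (fun ρ : ℝ => m ^ ρ) (𝓝[>] 0) (𝓝 1) :=
  ((Real.continuous_const_rpow hm.ne').tendsto' 0 1 (Real.rpow_zero m)).mono_left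
    nhdsWithin_le_nhds

theorem div_le_quotient {ρ x : ℝ} (hρ : 0 < ρ) (h : ENNReal.ofReal x ≤ dualPsi f ρ) :
    (((x - ballVolume n) / ρ : ℝ) : EReal) ≤
      ((dualPsi f ρ : EReal) - (dualPsi f 0 : EReal)) / (ρ : EReal) := by
  rw [coe_dualPsi_zero, EReal.coe_div, EReal.coe_sub]
  refine EReal.div_le_div_right_of_nonneg (by exact_mod_cast hρ.le) (EReal.sub_le_sub ?_ le_rfl)
  refine le_trans ?_ (EReal.coe_ennreal_le_coe_ennreal_iff.2 h)
  rw [EReal.coe_ennreal_ofReal]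
  exact_mod_cast le_max_left _ _

theorem quotient_le_div {ρ x : ℝ} (hρ : 0 < ρ) (hx : 0 ≤ x) (h : dualPsi f ρ ≤ ENNReal.ofReal x) :
    ((dualPsi f ρ : EReal) - (dualPsi f 0 : EReal)) / (ρ : EReal) ≤
      (((x - ballVolume n) / ρ : ℝ) : EReal) := by
  rw [coe_dualPsi_zero, EReal.coe_div, EReal.coe_sub]
  refine EReal.div_le_div_right_of_nonneg (by exact_mod_cast hρ.le) (EReal.sub_le_sub ?_ le_rfl)
  refine (EReal.coe_ennreal_le_coe_ennreal_iff.2 h).trans ?_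
  rw [EReal.coe_ennreal_ofReal, max_eq_left hx]

/-- The preceding lower bound, divided by `ρ`, tends to `κ log m + A` because `s ^ ρ → 1`. -/
theorem IsClassQ.eventually_lt_quotient (hf : IsClassQ f) {x₀ : EuclideanSpace ℝ (Fin n)}
    {m s A : ℝ} (hm : f x₀ = ENNReal.ofReal m) (hmax : ∀ x, f x ≤ f x₀) (hs : 0 < s) (hsm : s ≤ m)
    (hA : 0 ≤ A) (hV : ∀ ρ : ℝ, 0 < ρ → ENNReal.ofReal (ballVolume n + ρ * A) ≤
      volume (unitBall n + ρ • {x | ENNReal.ofReal s < f x}))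
    {a : EReal} (ha : a < ((ballVolume n * Real.log m + A : ℝ) : EReal)) :
    ∀ᶠ ρ : ℝ in 𝓝[>] 0, a < ((dualPsi f ρ : EReal) - (dualPsi f 0 : EReal)) / (ρ : EReal) := by
  have hlim : Tendsto (fun ρ : ℝ => ballVolume n * ((m ^ ρ - 1) / ρ) + A * s ^ ρ) (𝓝[>] 0)
      (𝓝 (ballVolume n * Real.log m + A)) := by
    simpa using ((tendsto_rpow_sub_one_div (hs.trans_le hsm)).const_mul (ballVolume n)).add
      ((tendsto_rpow_nhdsGT_zero hs).const_mul A)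
  have hlim' := (continuous_coe_real_ereal.tendsto _).comp hlim
  filter_upwards [hlim'.eventually_const_lt ha, self_mem_nhdsWithin] with ρ h1 hρ
  have hρ' : (0 : ℝ) < ρ := hρ
  refine h1.trans_le ?_
  have h2 := div_le_quotient hρ' (hf.ofReal_le_dualPsi hm hmax hs hsm hA hρ' (hV ρ hρ'))
  rw [Function.comp_apply]
  convert h2 using 2
  field_simp
  ring

theorem IsClassQ.convex_fnSupport (hf : IsClassQ f) : Convex ℝ (fnSupport f) :=
  (hf.convex_superlevel 0).closure

/-- The sets `{f > s k}` increase to `{f > 0}`, so continuity from below gives convergence of the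
parallel volumes; closures do not change these. -/
theorem IsClassQ.tendsto_quermassintegral_closedSuperlevel (hn : 1 ≤ n) (hf : IsClassQ f)
    (hK : IsCompact (fnSupport f)) {s : ℕ → ℝ} (hs : ∀ k, 0 < s k) (hanti : Antitone s)
    (hlim : Tendsto s atTop (𝓝 0)) {i : ℕ} (hi : i ≤ n) :
    Tendsto (fun k => quermassintegral i (closedSuperlevel f (s k))) atTop
      (𝓝 (quermassintegral i (fnSupport f))) := by
  refine tendsto_quermassintegral hn (fun k => hf.isCompact_closedSuperlevel (hs k))
    (fun k => hf.convex_closedSuperlevel _) hK hf.convex_fnSupport (fun ρ hρ => ?_) hi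
  have hC : Convex ℝ (ρ • unitBall n) := (convex_unitBall n).smul ρ
  have hunion : ⋃ k, (ρ • unitBall n + {x | ENNReal.ofReal (s k) < f x}) =
      ρ • unitBall n + {x | 0 < f x} := by
    rw [← Set.add_iUnion]
    congr 1
    ext x
    simp only [mem_iUnion, mem_ofPred_eq]
    refine ⟨fun ⟨k, hk⟩ => pos_of_gt hk, fun hx => ?_⟩
    have : Tendsto (fun k => ENNReal.ofReal (s k)) atTop (𝓝 0) := by
      simpa using ENNReal.tendsto_ofReal hlim
    exact (this.eventually_lt_const hx).exists
  have hmono : Monotone fun k => ρ • unitBall n + {x | ENNReal.ofReal (s k) < f x} :=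
    fun k l hkl => add_subset_add_left fun x hx =>
      (ENNReal.ofReal_le_ofReal (hanti hkl)).trans_lt hx
  have h := tendsto_measure_iUnion_atTop (μ := volume) hmono
  rw [hunion, ← volume_add_closure hC (hf.convex_superlevel 0)] at h
  simp only [measureReal_def]
  refine (ENNReal.tendsto_toReal ?_).comp ?_
  · exact (hK.add ((isCompact_unitBall n).smul ρ)).measure_ne_top
  · rw [add_comm (fnSupport f)]
    refine h.congr fun k => ?_
    rw [Function.comp_apply, ← volume_add_closure hC (hf.convex_superlevel _), add_comm]
    rfl

/-- The volume is affine in the length, so a lower bound at one length bounds the slope. At scale `2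
/ ‖u‖` the sum contains two disjoint unit balls around the ends of the segment. -/
theorem ballVolume_add_le_volume_symmSegment (hn : 1 ≤ n) (u : EuclideanSpace ℝ (Fin n)) {ρ : ℝ}
    (hρ : 0 ≤ ρ) : ballVolume n + ρ * (ballVolume n * ‖u‖ / 2) ≤
      volume.real (unitBall n + ρ • symmSegment u) := by
  obtain ⟨m, rfl⟩ : ∃ m, n = m + 1 := ⟨n - 1, by omega⟩
  rcases eq_or_ne u 0 with rfl | hu
  · have : symmSegment (0 : EuclideanSpace ℝ (Fin (m + 1))) = {0} := by
      simp only [symmSegment, smul_zero]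
      exact Nonempty.image_const ⟨0, by simp⟩ _
    simp [this, ballVolume]
  obtain ⟨c, hc⟩ : ∃ c : ℝ, ∀ r : ℝ, 0 ≤ r →
      volume.real (unitBall (m + 1) + r • symmSegment u) = ballVolume (m + 1) + r * c := by
    obtain ⟨P, c, -, hP⟩ := exists_volume_add_smul_symmSegment
      (PiLp.continuousLinearEquiv 2 ℝ (fun _ : Fin (m + 1) => ℝ) u)
    refine ⟨c * volume.real (P '' (euclideanToPi (m + 1) '' unitBall (m + 1))), fun r hr => ?_⟩
    have h := hP (euclideanToPi (m + 1) '' unitBall (m + 1))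
      ((isCompact_unitBall _).image (LinearMap.continuous_of_finiteDimensional _))
      ((convex_unitBall _).linear_image _) r hr
    rw [volume_real_euclideanToPi_image (isCompact_unitBall _)] at h
    rw [← volume_real_euclideanToPi_image ((isCompact_unitBall _).add
      ((isCompact_symmSegment u).smul r)), image_add, image_smul_set, image_symmSegment, ballVolume,
      ← mul_assoc]
    exact h
  have hu' : 0 < ‖u‖ := norm_pos_iff.2 hu
  have hr : 0 < 2 / ‖u‖ := by positivity
  have hdisj : Disjoint (Metric.closedBall ((2 / ‖u‖) • u) 1)
      (Metric.closedBall (-((2 / ‖u‖) • u)) 1) := by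
    refine Metric.closedBall_disjoint_closedBall ?_
    rw [dist_eq_norm, sub_neg_eq_add, ← two_smul ℝ ((2 / ‖u‖) • u), norm_smul, norm_smul,
      Real.norm_of_nonneg hr.le, div_mul_cancel₀ _ hu'.ne']
    norm_num
  have hsub : Metric.closedBall ((2 / ‖u‖) • u) 1 ∪ Metric.closedBall (-((2 / ‖u‖) • u)) 1 ⊆
      unitBall (m + 1) + (2 / ‖u‖) • symmSegment u := by
    have key : ∀ t ∈ Icc (-1 : ℝ) 1, Metric.closedBall ((2 / ‖u‖) • t • u) 1 ⊆
        unitBall (m + 1) + (2 / ‖u‖) • symmSegment u := fun t ht z hz =>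
      ⟨z - (2 / ‖u‖) • t • u, by
        rwa [unitBall, mem_closedBall_zero_iff, ← dist_eq_norm], _,
        smul_mem_smul_set ⟨t, ht, rfl⟩, by simp⟩
    refine union_subset ?_ ?_
    · simpa using key 1 (by simp)
    · simpa using key (-1) (by simp)
  have hball : ∀ z : EuclideanSpace ℝ (Fin (m + 1)),
      volume.real (Metric.closedBall z 1) = ballVolume (m + 1) := fun z => by
    rw [ballVolume, unitBall, measureReal_def, measureReal_def,
      Measure.addHaar_closedBall_center volume z]
  have h2 := measureReal_mono (μ := volume) hsub
    ((isCompact_unitBall _).add ((isCompact_symmSegment u).smul _)).measure_ne_top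
  rw [measureReal_union hdisj Metric.isClosed_closedBall.measurableSet
    (isCompact_closedBall _ _).measure_ne_top (isCompact_closedBall _ _).measure_ne_top,
    hball, hball, hc _ hr.le] at h2
  rw [hc ρ hρ]
  have h3 : ballVolume (m + 1) * ‖u‖ / 2 ≤ c := by
    have h4 : ballVolume (m + 1) ≤ 2 / ‖u‖ * c := by linarith
    rw [div_mul_eq_mul_div, le_div_iff₀ hu'] at h4
    linarith
  have := mul_le_mul_of_nonneg_left h3 hρ
  linarith

/-- If the support is not compact, some `y` with `f y > 0` lies arbitrarily far from `x₀`, and by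
quasi-concavity a superlevel set contains the whole segment between them. -/
theorem IsClassQ.exists_volume_bound_of_not_isCompact (hn : 1 ≤ n) (hf : IsClassQ f)
    {x₀ : EuclideanSpace ℝ (Fin n)} {m : ℝ} (hm0 : 0 < m) (hm : f x₀ = ENNReal.ofReal m)
    (hmax : ∀ x, f x ≤ f x₀) (hK : ¬ IsCompact (fnSupport f)) (A : ℝ) :
    ∃ s, 0 < s ∧ s ≤ m ∧ ∀ ρ : ℝ, 0 < ρ → ENNReal.ofReal (ballVolume n + ρ * A) ≤
      volume (unitBall n + ρ • {x | ENNReal.ofReal s < f x}) := by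
  have hκ := ballVolume_pos n
  -- The segment has half-length `‖y - x₀‖ / 2` and contributes slope at least `κ ‖y - x₀‖ / 4`,
  -- whence the threshold `4 * A / κ`.
  obtain ⟨y, hy0, hy⟩ : ∃ y, 0 < f y ∧ 4 * A / ballVolume n < ‖y - x₀‖ := by
    by_contra! h
    refine hK (Metric.isCompact_of_isClosed_isBounded isClosed_closure
      (Bornology.IsBounded.closure ?_))
    refine (Metric.isBounded_closedBall (x := x₀) (r := 4 * A / ballVolume n)).subset fun y hy => ?_
    rw [Metric.mem_closedBall, dist_eq_norm]
    exact h y hy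
  obtain ⟨s', hs0, hsy⟩ := ENNReal.lt_iff_exists_nnreal_btwn.1 hy0
  have hs'y : ENNReal.ofReal (s' : ℝ) < f y := by simpa using hsy
  have hs'x : ENNReal.ofReal (s' : ℝ) < f x₀ := hs'y.trans_le (hmax y)
  refine ⟨s', by exact_mod_cast hs0, ?_, fun ρ hρ => ?_⟩
  · rw [hm, ENNReal.ofReal_lt_ofReal_iff hm0] at hs'x
    exact hs'x.le
  set u : EuclideanSpace ℝ (Fin n) := (1 / 2 : ℝ) • (y - x₀) with hu
  have hsub : ρ • (x₀ + u) +ᵥ (unitBall n + ρ • symmSegment u) ⊆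
      unitBall n + ρ • {x | ENNReal.ofReal s' < f x} := by
    rintro _ ⟨_, ⟨b, hb, _, ⟨_, ⟨t, ht, rfl⟩, rfl⟩, rfl⟩, rfl⟩
    refine ⟨b, hb, _, smul_mem_smul_set (a := ρ) (b := x₀ + u + t • u) ?_, ?_⟩
    · have := hf.convex_superlevel (ENNReal.ofReal s') hs'x hs'y (a := (1 - t) / 2)
        (b := (1 + t) / 2) (by linarith [ht.2]) (by linarith [ht.1]) (by ring)
      convert this using 1
      rw [hu]
      module
    · simp only [smul_add, vadd_eq_add]
      abel
  refine le_trans ?_ (measure_mono hsub)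
  rw [measure_vadd, ← ENNReal.ofReal_toReal (a := volume (unitBall n + ρ • symmSegment u))
    (isCompact_unitBall_add_smul (isCompact_symmSegment u) ρ).measure_ne_top]
  refine ENNReal.ofReal_le_ofReal (le_trans ?_ (ballVolume_add_le_volume_symmSegment hn u hρ.le))
  have hun : ‖u‖ = ‖y - x₀‖ / 2 := by
    rw [hu, norm_smul]; norm_num; ring
  rw [div_lt_iff₀ hκ] at hy
  have : A ≤ ballVolume n * ‖u‖ / 2 := by rw [hun]; linarith
  have := mul_le_mul_of_nonneg_left this hρ.le
  linarith

theorem IsClassQ.tendsto_quotient_of_isCompact (hn : 1 ≤ n) (hf : IsClassQ f)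
    {x₀ : EuclideanSpace ℝ (Fin n)} {m : ℝ} (hm0 : 0 < m) (hm : f x₀ = ENNReal.ofReal m)
    (hmax : ∀ x, f x ≤ f x₀) (hK : IsCompact (fnSupport f)) :
    Tendsto (fun ρ : ℝ => ((dualPsi f ρ : EReal) - (dualPsi f 0 : EReal)) / (ρ : EReal)) (𝓝[>] 0)
      (𝓝 ((ballVolume n * Real.log m + n * quermassintegral (n - 1) (fnSupport f) : ℝ) : EReal)) := by
  have hne : (fnSupport f).Nonempty := ⟨x₀, subset_closure (by simp [hm, hm0])⟩
  refine tendsto_order.2 ⟨fun a ha => ?_, fun a ha => ?_⟩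
  -- Heights decreasing to zero and staying below `m`, so that every superlevel set contains `x₀`.
  · set s : ℕ → ℝ := fun k => m / 2 * (1 / ((k : ℝ) + 1)) with hs
    have hs0 : ∀ k, 0 < s k := fun k => by positivity
    have hs1 : ∀ k, s k < m := fun k => by
      have : 1 / ((k : ℝ) + 1) ≤ 1 := by
        rw [div_le_one (by positivity)]; linarith [k.cast_nonneg (α := ℝ)]
      rw [hs]; dsimp only; nlinarith
    have hlim : Tendsto s atTop (𝓝 0) := by
      simpa only [mul_zero] using
        (tendsto_one_div_add_atTop_nhds_zero_nat (𝕜 := ℝ)).const_mul (m / 2)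
    have hanti : Antitone s := fun k l hkl => by
      rw [hs]; dsimp only; gcongr
    have h1 := ((hf.tendsto_quermassintegral_closedSuperlevel hn hK hs0 hanti hlim
      (Nat.sub_le n 1)).const_mul (n : ℝ)).const_add (ballVolume n * Real.log m)
    have h2 := (continuous_coe_real_ereal.tendsto _).comp h1
    obtain ⟨k, hk⟩ := (h2.eventually_const_lt ha).exists
    have hKk := hf.isCompact_closedSuperlevel (hs0 k)
    have hck := hf.convex_closedSuperlevel (s k)
    refine hf.eventually_lt_quotient hm hmax (hs0 k) (hs1 k).le
      (mul_nonneg n.cast_nonneg (quermassintegral_nonneg hn hKk hck (n - 1))) (fun ρ hρ => ?_) hk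
    rw [← volume_unitBall_add_smul_closure (hf.convex_superlevel _)]
    refine ENNReal.ofReal_le_of_le_toReal (ballVolume_add_le_volume hn hKk hck ?_ hρ)
    exact ⟨x₀, subset_closure (by
      rw [mem_ofPred_eq, hm]; exact (ENNReal.ofReal_lt_ofReal_iff hm0).2 (hs1 k))⟩
  · obtain ⟨N, rfl⟩ : ∃ N, n = N + 1 := ⟨n - 1, by omega⟩
    set W := quermassintegral (N + 1 - 1) (fnSupport f) with hW
    -- The part of degree at least two in `|B + ρK_f|` is `ρ ^ 2 * r ρ`; it disappears from the
    -- quotient in the limit.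
    set r : ℝ → ℝ := fun ρ => ∑ k ∈ Finset.range N, ((N + 1).choose (k + 1 + 1) : ℝ) *
      quermassintegral (N + 1 - (k + 1 + 1)) (fnSupport f) * ρ ^ k with hr
    have hrc : Continuous r := by fun_prop
    have hq : ∀ ρ : ℝ, 0 < ρ → volume.real (unitBall (N + 1) + ρ • fnSupport f) =
        ballVolume (N + 1) + ρ * ((N + 1 : ℕ) * W + ρ * r ρ) := fun ρ hρ => by
      rw [volume_real_unitBall_add_smul hn hK hf.convex_fnSupport hρ, Finset.sum_range_succ',
        Finset.sum_range_succ', ← quermassintegral_dim hn hK hf.convex_fnSupport hne]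
      have : ∑ k ∈ Finset.range N, ((N + 1).choose (k + 1 + 1) : ℝ) *
          quermassintegral (N + 1 - (k + 1 + 1)) (fnSupport f) * ρ ^ (k + 1 + 1) =
          ρ * (ρ * r ρ) := by
        rw [hr]; dsimp only
        rw [Finset.mul_sum, Finset.mul_sum]
        exact Finset.sum_congr rfl fun k _ => by ring
      rw [this]
      simp [hW]
      ring
    have hlim : Tendsto (fun ρ : ℝ => ballVolume (N + 1) * ((m ^ ρ - 1) / ρ) +
        m ^ ρ * ((N + 1 : ℕ) * W + ρ * r ρ)) (𝓝[>] 0)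
        (𝓝 (ballVolume (N + 1) * Real.log m + (N + 1 : ℕ) * W)) := by
      have h1 : Tendsto (fun ρ : ℝ => (N + 1 : ℕ) * W + ρ * r ρ) (𝓝[>] 0)
          (𝓝 ((N + 1 : ℕ) * W)) := by
        have : Continuous fun ρ : ℝ => (N + 1 : ℕ) * W + ρ * r ρ := by fun_prop
        exact (this.tendsto' 0 _ (by simp)).mono_left nhdsWithin_le_nhds
      simpa using ((tendsto_rpow_sub_one_div hm0).const_mul (ballVolume (N + 1))).add
        ((tendsto_rpow_nhdsGT_zero hm0).mul h1)
    have hlim' := (continuous_coe_real_ereal.tendsto _).comp hlim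
    filter_upwards [hlim'.eventually_lt_const ha, self_mem_nhdsWithin] with ρ h1 hρ
    have hρ' : (0 : ℝ) < ρ := hρ
    refine lt_of_le_of_lt ?_ h1
    have h2 := quotient_le_div hρ' (by positivity) (hf.dualPsi_le hm0 hm hmax hρ' hK)
    rw [Function.comp_apply]
    convert h2 using 2
    rw [hq ρ hρ']
    field_simp
    ring

theorem IsClassQ.tendsto_quotient_of_not_isCompact (hn : 1 ≤ n) (hf : IsClassQ f)
    {x₀ : EuclideanSpace ℝ (Fin n)} {m : ℝ} (hm0 : 0 < m) (hm : f x₀ = ENNReal.ofReal m)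
    (hmax : ∀ x, f x ≤ f x₀) (hK : ¬ IsCompact (fnSupport f)) :
    Tendsto (fun ρ : ℝ => ((dualPsi f ρ : EReal) - (dualPsi f 0 : EReal)) / (ρ : EReal)) (𝓝[>] 0)
      (𝓝 ⊤) := by
  refine EReal.tendsto_nhds_top_iff_real.2 fun x => ?_
  -- The choice makes `κ log m + A` exceed `x` while keeping `A` nonnegative.
  set A := max 0 (x - ballVolume n * Real.log m + 1)
  obtain ⟨s, hs, hsm, hV⟩ := hf.exists_volume_bound_of_not_isCompact hn hm0 hm hmax hK A
  refine hf.eventually_lt_quotient hm hmax hs hsm (le_max_left _ _) hV ?_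
  have : x - ballVolume n * Real.log m + 1 ≤ A := le_max_right _ _
  exact EReal.coe_lt_coe_iff.2 (by linarith)

end DualSteiner

/-! ### The theorem -/

theorem theorem3p6 (n : ℕ) (hn : 1 ≤ n) (f : EuclideanSpace ℝ (Fin n) → ℝ≥0∞)
    (hf : IsClassQLog f) :
    (∀ ρ : ℝ, 0 < ρ →
      dualPsi f ρ = ∑ j ∈ Finset.range (n + 1),
        (n.choose j : ℝ≥0∞) * ENNReal.ofReal (ρ ^ (j + 1)) *
          ∫⁻ t in Ioi (0 : ℝ),
            ENNReal.ofReal (quermassintegral (n - j) (closedSuperlevel f t) * t ^ (ρ - 1))) ∧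
    (∃ m : ℝ≥0∞, IsGreatest (range f) m ∧
      (IsCompact (fnSupport f) →
        Tendsto (fun ρ : ℝ => ((dualPsi f ρ : EReal) - (dualPsi f 0 : EReal)) / (ρ : EReal))
          (𝓝[>] 0)
          (𝓝 ((ballVolume n : EReal) * ENNReal.log m +
            ((n * quermassintegral (n - 1) (fnSupport f) : ℝ) : EReal)))) ∧
      (¬ IsCompact (fnSupport f) →
        Tendsto (fun ρ : ℝ => ((dualPsi f ρ : EReal) - (dualPsi f 0 : EReal)) / (ρ : EReal))
          (𝓝[>] 0) (𝓝 ⊤))) := by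
  have hQ := hf.toIsClassQ
  obtain ⟨x₀, hmax⟩ := hQ.exists_isMax
  refine ⟨fun ρ hρ => hQ.dualPsi_eq_sum hn hρ, f x₀,
    ⟨mem_range_self x₀, forall_mem_range.2 hmax⟩, ?_⟩
  by_cases htop : f x₀ = ⊤
  -- When the maximum is infinite, Ψ is infinite for every `ρ > 0` and the quotient is constantly
  -- `⊤`, which agrees with both cases since `log ⊤ = ⊤`.
  · have h : Tendsto (fun ρ : ℝ => ((dualPsi f ρ : EReal) - (dualPsi f 0 : EReal)) / (ρ : EReal))
        (𝓝[>] 0) (𝓝 ⊤) := by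
      refine tendsto_const_nhds.congr' ?_
      filter_upwards [self_mem_nhdsWithin] with ρ hρ
      have hρ' : (0 : ℝ) < ρ := hρ
      rw [dualPsi_eq_top htop hρ', coe_dualPsi_zero, EReal.coe_ennreal_top, EReal.top_sub_coe,
        EReal.top_div_of_pos_ne_top (by exact_mod_cast hρ') (EReal.coe_ne_top _)]
    refine ⟨fun _ => ?_, fun _ => h⟩
    rwa [htop, ENNReal.log_top, EReal.coe_mul_top_of_pos (ballVolume_pos n), EReal.top_add_coe]
  · have hpos : 0 < f x₀ := by
      obtain ⟨x, hx⟩ := hQ.ne_zero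
      exact (pos_iff_ne_zero.2 hx).trans_le (hmax x)
    have hm0 : 0 < (f x₀).toReal := ENNReal.toReal_pos hpos.ne' htop
    have hm : f x₀ = ENNReal.ofReal (f x₀).toReal := (ENNReal.ofReal_toReal htop).symm
    refine ⟨fun hK => ?_, hQ.tendsto_quotient_of_not_isCompact hn hm0 hm hmax⟩
    have := hQ.tendsto_quotient_of_isCompact hn hm0 hm hmax hK
    rw [EReal.coe_add, EReal.coe_mul, ← ENNReal.log_ofReal_of_pos hm0, ← hm] at this
    exact this
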